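/- Let $F$ be a totally real number field with ring of integers $\mathcal{O}$ and different $\mathfrak{d}$. Let $\hat F$ be the ring of finite adeles of $F$ and $\hat{\mathcal{O}}\subset\hat F$ the subring of integral finite adeles. Let $V$ be a finite-dimensional $F$-vector space with a non-degenerate quadratic form $Q$ and bilinear form $(x,y)=Q(x+y)-Q(x)-Q(y)$, and let $L\subset V$ be an $\mathcal{O}$-lattice (a finitely generated $\mathcal{O}$-submodule spanning $V$ over $F$) of rank at least $5$. Suppose that $L$ is even, i.e. $Q(L)\subset\mathfrak{d}^{-1}$, and $\mathbb{Z}$-unimodular, i.e. $L=\{y\in V : (y,L)\subset\mathfrak{d}^{-1}\}$. Put $\hat V=\hat F\otimes_F V$ and let $\hat L\subset\hat V$ be the $\hat{\mathcal{O}}$-submodule generated by $L$. Let $H_V=\mathrm{Res}_{F/\mathbb{Q}}\mathrm{GSpin}_V$, so that $H_V(\hat{\mathbb{Q}})=\mathrm{GSpin}_V(\hat F)$ is the group of invertible elements $g$ of the even Clifford algebra of $(\hat V,Q)$ with $g\hat Vg^{-1}=\hat V$, equipped with the adelic topology; it acts on $\hat V$ by $v\mapsto gvg^{-1}$, and the spinor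 norm is $\nu(g)=g\,g^{t}\in\hat F^\times$, where $t$ is the anti-involution of the Clifford algebra that is the identity on $\hat V$. Then there is an open compact subgroup $K\subset H_V(\hat{\mathbb{Q}})$ that stabilizes $\hat L$ (i.e. $k\cdot\hat L=\hat L$ for all $k\in K$) and satisfies $\nu(K)=\hat{\mathcal{O}}^\times$ in $\hat F^\times$. -/

import Mathlib

open scoped TensorProduct NumberField nonZeroDivisors

/-! ### The general spin group over a commutative ring -/

namespace GeneralSpin

variable {R M : Type*} [CommRing R] [AddCommGroup M] [Module R M]

/-- `GSpin(M, Q)`: the invertible elements `g` of the even Clifford algebra (that is, `g` and `g⁻¹`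
are even) with `g M g⁻¹ = M`, where `M` is identified with its image in the Clifford algebra. -/
def GSpin (Q : QuadraticForm R M) : Subgroup (CliffordAlgebra Q)ˣ where
  carrier := {g | g ∈ (CliffordAlgebra.even Q).toSubmonoid.units ∧
    ∀ x : CliffordAlgebra Q, x ∈ LinearMap.range (CliffordAlgebra.ι Q) ↔
      (g : CliffordAlgebra Q) * x * (↑g⁻¹ : CliffordAlgebra Q) ∈
        LinearMap.range (CliffordAlgebra.ι Q)}
  one_mem' := ⟨one_mem _, fun x => by simp⟩
  mul_mem' := by
    rintro a b ⟨ha, ha'⟩ ⟨hb, hb'⟩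
    refine ⟨mul_mem ha hb, fun x => ?_⟩
    rw [hb' x, ha']
    simp only [Units.val_mul, mul_inv_rev, mul_assoc]
  inv_mem' := by
    rintro a ⟨ha, ha'⟩
    refine ⟨inv_mem ha, fun x => ?_⟩
    rw [ha' ((↑a⁻¹ : CliffordAlgebra Q) * x * (↑(a⁻¹)⁻¹ : CliffordAlgebra Q))]
    simp [mul_assoc]

variable {Q : QuadraticForm R M}

theorem exists_act (g : GSpin Q) (m : M) : ∃ m' : M, CliffordAlgebra.ι Q m' =
    ((g : (CliffordAlgebra Q)ˣ) : CliffordAlgebra Q) * CliffordAlgebra.ι Q m *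
      ((g⁻¹ : (CliffordAlgebra Q)ˣ) : CliffordAlgebra Q) :=
  (g.2.2 (CliffordAlgebra.ι Q m)).1 ⟨m, rfl⟩

/-- The action of `GSpin(M, Q)` on `M` through conjugation: `g · m` is the vector with
`ι (g · m) = g * ι m * g⁻¹` (unique when `2` is invertible in `R`, since then `ι` is injective). -/
noncomputable def act (g : GSpin Q) (m : M) : M := (exists_act g m).choose

theorem ι_act (g : GSpin Q) (m : M) : CliffordAlgebra.ι Q (act g m) =
    ((g : (CliffordAlgebra Q)ˣ) : CliffordAlgebra Q) * CliffordAlgebra.ι Q m *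
      ((g⁻¹ : (CliffordAlgebra Q)ˣ) : CliffordAlgebra Q) :=
  (exists_act g m).choose_spec

/-- The spinor norm `ν(g) = g * gᵗ`, where `t` is the anti-automorphism of the Clifford algebra
fixing all vectors. It is taken in the Clifford algebra, which contains the scalars. -/
def spinorNorm (g : GSpin Q) : CliffordAlgebra Q :=
  ((g : (CliffordAlgebra Q)ˣ) : CliffordAlgebra Q) *
    CliffordAlgebra.reverse ((g : (CliffordAlgebra Q)ˣ) : CliffordAlgebra Q)

end GeneralSpin

/-! ### Even unimodular lattices over a number field -/

section Lattices

variable {F : Type*} [Field F] [NumberField F]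
variable {V : Type*} [AddCommGroup V] [Module F V] [Module (𝓞 F) V] [IsScalarTower (𝓞 F) F V]

/-- The inverse different `𝔡⁻¹` of `F / ℚ`. -/
noncomputable def inverseDifferent (F : Type*) [Field F] [NumberField F] :
    FractionalIdeal (𝓞 F)⁰ F :=
  (differentIdeal ℤ (𝓞 F) : FractionalIdeal (𝓞 F)⁰ F)⁻¹

/-- `Q(L) ⊆ 𝔡⁻¹`. -/
def IsEvenLattice (Q : QuadraticForm F V) (L : Submodule (𝓞 F) V) : Prop :=
  ∀ x ∈ L, Q x ∈ inverseDifferent F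

/-- `L' = {y ∈ V : (y, L) ⊆ 𝔡⁻¹}` for the bilinear form `(x, y) = Q(x + y) - Q(x) - Q(y)`. -/
def latticeDual (Q : QuadraticForm F V) (L : Submodule (𝓞 F) V) : Set V :=
  {y | ∀ x ∈ L, QuadraticMap.polar Q y x ∈ inverseDifferent F}

/-- `L' = L`. -/
def IsZUnimodular (Q : QuadraticForm F V) (L : Submodule (𝓞 F) V) : Prop :=
  latticeDual Q L = (L : Set V)

end Lattices

/-! ### Adelic objects -/

/-- The ring `F̂` of finite adeles of `F`. -/
abbrev FinAdeles (F : Type*) [Field F] [NumberField F] : Type _ :=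
  IsDedekindDomain.FiniteAdeleRing (𝓞 F) F

/-- The subring `Ô` of integral finite adeles. -/
noncomputable def integralAdeles (F : Type*) [Field F] [NumberField F] : Subring (FinAdeles F) where
  carrier := {a | ∀ v : IsDedekindDomain.HeightOneSpectrum (𝓞 F), a v ∈ v.adicCompletionIntegers F}
  zero_mem' v := zero_mem (v.adicCompletionIntegers F)
  one_mem' v := one_mem (v.adicCompletionIntegers F)
  add_mem' ha hb v := add_mem (ha v) (hb v)
  mul_mem' ha hb v := mul_mem (ha v) (hb v)
  neg_mem' ha v := neg_mem (ha v)

/-- The group `Ô^×`, as a subgroup of `F̂^×`. -/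
noncomputable def integralIdeles (F : Type*) [Field F] [NumberField F] : Subgroup (FinAdeles F)ˣ :=
  (integralAdeles F).toSubmonoid.units

section Adelic

variable {F : Type*} [Field F] [NumberField F]
variable {V : Type*} [AddCommGroup V] [Module F V] [Module (𝓞 F) V] [IsScalarTower (𝓞 F) F V]

/-- The base change of `Q` to the finite adeles, a quadratic form on `V̂ = F̂ ⊗ V`. -/
noncomputable def adelicForm (Q : QuadraticForm F V) :
    QuadraticForm (FinAdeles F) (FinAdeles F ⊗[F] V) :=
  letI : Invertible (2 : F) := invertibleOfNonzero two_ne_zero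
  Q.baseChange (FinAdeles F)

/-- The adelic topology on `C(V)(F̂)`: the module topology over `F̂`, which is the product topology
for any `F̂`-basis. -/
noncomputable instance adelicCliffordTopology (Q : QuadraticForm F V) :
    TopologicalSpace (CliffordAlgebra (adelicForm Q)) :=
  moduleTopology (FinAdeles F) _

/-- `H_V(ℚ̂) = GSpin_V(F̂)` for `H_V = Res_{F/ℚ} GSpin_V`. As a subgroup of the units of the
topological ring `C(V)(F̂)` it carries the adelic topology. -/
abbrev AdelicGSpin (Q : QuadraticForm F V) : Type _ := GeneralSpin.GSpin (adelicForm Q)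

/-- `L̂ = L ⊗ Ô`, realized as the `Ô`-submodule of `V̂` generated by `L`. -/
noncomputable def latticeHat (L : Submodule (𝓞 F) V) :
    Submodule (integralAdeles F) (FinAdeles F ⊗[F] V) :=
  Submodule.span (integralAdeles F) ((fun x : V => (1 : FinAdeles F) ⊗ₜ[F] x) '' (L : Set V))

end Adelic

/-! The spinor norm already takes every value in `Ô^×` on a one-dimensional torus preserving `L̂`.
Suppose `e, f ∈ L̂` are isotropic and `d` is a finite adele with `d (e, f) = 1`. Then `p = d e f`
and `p' = d f e` are complementary idempotents of the even Clifford algebra exchanged by the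
reversal `t`, so `g = p + u p'` satisfies `ν(g) = u` for every unit `u`. Conjugation by `g` scales
`e` by `u⁻¹` and `f` by `u`, and fixes the vectors orthogonal to both. If moreover `d (L̂, L̂) ⊆ Ô`
and `u ∈ Ô^×`, it preserves `L̂` (`hyperbolicUnit_conj`).

Such a pair is found place by place. A local generator `d` of the different makes `d Q` integral on
`L`, and unimodularity makes its polar form non-degenerate modulo the prime. By Chevalley–Warning
(`exists_ternary_zero`), three vectors independent modulo the prime have a combination `x` that is
isotropic modulo the prime and nonzero there, and non-degeneracy provides `y` with `d (x, y)` a unit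
(`exists_isotropic_mod`). Hensel's lemma deforms `x, y` to a hyperbolic pair
(`exists_hyperbolic_of_isotropic_mod`). The local pairs have integral coordinates, so they assemble
to adelic vectors in `L̂`.

The group `K` consists of the `g` such that `g` and `g⁻¹` preserve `L̂`, preserve a compact open
lattice `Λ` of the Clifford algebra under left multiplication, and have integral spinor norm. If `Λ`
is stable under `p` and `p'`, then `K` contains the torus elements with `u ∈ Ô^×`. Conversely the
spinor norm is scalar (`exists_spinorNorm_eq_algebraMap`), and its values on `K` are integral with
integral inverse. Compactness of `Ô` makes `K` open, and `1 ∈ Λ` makes it compact. -/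

/-! ### Compactness of the local integers and of the integral adeles. -/

section Completion

open IsDedekindDomain HeightOneSpectrum

variable {F : Type*} [Field F] [NumberField F] (v : HeightOneSpectrum (𝓞 F))

theorem exists_integer_valued_sub_lt_one {x : v.adicCompletion F}
    (hx : x ∈ v.adicCompletionIntegers F) :
    ∃ r : 𝓞 F, Valued.v (x - algebraMap (𝓞 F) (v.adicCompletion F) r) < 1 := by
  have hopen : IsOpen {y : v.adicCompletion F | Valued.v (x - y) < 1} := by
    have h : IsOpen {y : v.adicCompletion F | Valued.v y < 1} := by
      simpa using Valued.isOpen_ball (v.adicCompletion F) 1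
    exact h.preimage (continuous_const.sub continuous_id)
  obtain ⟨k, hk⟩ := (denseRange_algebraMap F v).exists_mem_open hopen ⟨x, by simp⟩
  have hk1 : v.valuation F k ≤ 1 := by
    rw [← valuedAdicCompletion_eq_valuation' v k]
    have h2 : ((k : F) : v.adicCompletion F) = x - (x - algebraMap F (v.adicCompletion F) k) := by
      rw [sub_sub_cancel]; rfl
    rw [h2]
    exact (Valuation.map_sub _ _ _).trans (max_le hx hk.le)
  obtain ⟨r, hr⟩ := v.exists_valuation_sub_lt_of_integer hk1 1
  refine ⟨r, ?_⟩
  have h3 : x - algebraMap (𝓞 F) (v.adicCompletion F) r =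
      (x - algebraMap F (v.adicCompletion F) k) +
        algebraMap F (v.adicCompletion F) (k - algebraMap (𝓞 F) F r) := by
    rw [map_sub, ← IsScalarTower.algebraMap_apply]; ring
  rw [h3]
  refine (Valuation.map_add _ _ _).trans_lt (max_lt hk ?_)
  have h4 := valuedAdicCompletion_eq_valuation' v (k - algebraMap (𝓞 F) F r)
  refine lt_of_eq_of_lt h4 ?_
  first | exact hr | (rw [Valuation.map_sub_swap]; exact hr)

/-- By density of `F` in the completion, every residue class contains an element of `𝓞 F`, so the
finite ring `𝓞 F ⧸ v` surjects onto the residue field. -/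
theorem finite_residueField_adicCompletionIntegers :
    Finite (IsLocalRing.ResidueField (v.adicCompletionIntegers F)) := by
  have : Finite (𝓞 F ⧸ v.asIdeal) := v.asIdeal.finiteQuotientOfFreeOfNeBot v.ne_bot
  let φ : 𝓞 F →+* IsLocalRing.ResidueField (v.adicCompletionIntegers F) :=
    (IsLocalRing.residue _).comp (algebraMap (𝓞 F) (v.adicCompletionIntegers F))
  have hmem : ∀ y : v.adicCompletionIntegers F, Valued.v (y : v.adicCompletion F) < 1 →
      IsLocalRing.residue _ y = 0 := by
    intro y hy
    rw [IsLocalRing.residue_eq_zero_iff, IsLocalRing.mem_maximalIdeal, mem_nonunits_iff,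
      adicCompletionIntegers.isUnit_iff_valued_eq_one]
    exact hy.ne
  have hφ : ∀ a ∈ v.asIdeal, φ a = 0 := by
    intro a ha
    refine hmem _ ?_
    refine lt_of_eq_of_lt (valuedAdicCompletion_eq_valuation v a) ?_
    exact (v.valuation_lt_one_iff_mem a).2 ha
  refine Finite.of_surjective (Ideal.Quotient.lift v.asIdeal φ hφ) fun z => ?_
  obtain ⟨y, rfl⟩ := IsLocalRing.residue_surjective z
  obtain ⟨r, hr⟩ := exists_integer_valued_sub_lt_one v y.2
  refine ⟨Ideal.Quotient.mk _ r, ?_⟩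
  rw [Ideal.Quotient.lift_mk, eq_comm, ← sub_eq_zero]
  have := hmem (y - algebraMap (𝓞 F) (v.adicCompletionIntegers F) r) hr
  rw [map_sub] at this
  exact this

theorem compactSpace_adicCompletionIntegers : CompactSpace (v.adicCompletionIntegers F) := by
  have h := (Valued.integer.compactSpace_iff_completeSpace_and_isDiscreteValuationRing_and_finite_residueField
    (K := v.adicCompletion F)).2
  refine h ⟨?_, ?_, ?_⟩
  · exact (Valued.isClosed_valuationSubring (v.adicCompletion F)).completeSpace_coe
  · exact inferInstanceAs (IsDiscreteValuationRing (v.adicCompletionIntegers F))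
  · exact finite_residueField_adicCompletionIntegers v

theorem isOpen_integralAdeles : IsOpen (integralAdeles F : Set (FinAdeles F)) :=
  RestrictedProduct.isOpen_forall_mem
    (fun w : HeightOneSpectrum (𝓞 F) => Valued.isOpen_valuationSubring (w.adicCompletion F))

theorem isCompact_integralAdeles : IsCompact (integralAdeles F : Set (FinAdeles F)) := by
  have := fun w : HeightOneSpectrum (𝓞 F) => compactSpace_adicCompletionIntegers w
  have h := isCompact_range (RestrictedProduct.isEmbedding_structureMap
    (R := fun w : HeightOneSpectrum (𝓞 F) => w.adicCompletion F)
    (A := fun w => (w.adicCompletionIntegers F : Set (w.adicCompletion F)))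
    (𝓕 := Filter.cofinite)).continuous
  rw [RestrictedProduct.range_structureMap] at h
  exact h

theorem t2Space_finAdeles : T2Space (FinAdeles F) :=
  inferInstanceAs (T2Space (RestrictedProduct
    (fun w : HeightOneSpectrum (𝓞 F) => w.adicCompletion F)
    (fun w => (w.adicCompletionIntegers F : Set (w.adicCompletion F))) Filter.cofinite))

end Completion

/-! ### Words in an orthogonal basis, and scalarity of the spinor norm. -/

namespace GeneralSpin

open CliffordAlgebra

variable {R M : Type*} [CommRing R] [AddCommGroup M] [Module R M] {Q : QuadraticForm R M}

section Words

variable {I : Type*} (Q) (b : I → M)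

/-- The product in the Clifford algebra of the vectors `b i` for `i` running through a list. -/
def wordProd (l : List I) : CliffordAlgebra Q := (l.map fun i => ι Q (b i)).prod

variable {Q b}

@[simp] theorem wordProd_nil : wordProd Q b [] = 1 := by simp [wordProd]

@[simp] theorem wordProd_cons (i : I) (l : List I) :
    wordProd Q b (i :: l) = ι Q (b i) * wordProd Q b l := by simp [wordProd]

theorem ι_mul_mem_span_wordProd (hb : Submodule.span R (Set.range b) = ⊤) (m : M)
    {P P' : List I → Prop} (hP : ∀ i l, P l → P' (i :: l)) {x : CliffordAlgebra Q}
    (hx : x ∈ Submodule.span R (wordProd Q b '' {l | P l})) :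
    ι Q m * x ∈ Submodule.span R (wordProd Q b '' {l | P' l}) := by
  have hm : m ∈ Submodule.span R (Set.range b) := hb ▸ Submodule.mem_top
  induction hm using Submodule.span_induction with
  | mem y hy =>
    obtain ⟨i, rfl⟩ := hy
    induction hx using Submodule.span_induction with
    | mem z hz =>
      obtain ⟨l, hl, rfl⟩ := hz
      exact Submodule.subset_span ⟨i :: l, hP i l hl, by simp⟩
    | zero => simp
    | add _ _ _ _ h1 h2 => rw [mul_add]; exact add_mem h1 h2
    | smul r _ _ h => rw [mul_smul_comm]; exact Submodule.smul_mem _ r h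
  | zero => simp
  | add _ _ _ _ h1 h2 => rw [map_add, add_mul]; exact add_mem h1 h2
  | smul r _ _ h => rw [map_smul, smul_mul_assoc]; exact Submodule.smul_mem _ r h

theorem mem_span_wordProd_of_mem_even (hb : Submodule.span R (Set.range b) = ⊤)
    {x : CliffordAlgebra Q} (hx : x ∈ even Q) :
    x ∈ Submodule.span R (wordProd Q b '' {l | Even l.length}) := by
  refine even_induction Q (motive := fun x _ =>
    x ∈ Submodule.span R (wordProd Q b '' {l | Even l.length})) ?_ ?_ ?_ x hx
  · intro r
    rw [Algebra.algebraMap_eq_smul_one]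
    exact Submodule.smul_mem _ _ (Submodule.subset_span ⟨[], by simp, by simp⟩)
  · intro x y _ _ h1 h2
    exact add_mem h1 h2
  · intro m₁ m₂ x _ h
    rw [mul_assoc]
    refine ι_mul_mem_span_wordProd hb m₁ (P := fun l => Odd l.length)
      (fun i l hl => by simpa using hl.add_one) ?_
    exact ι_mul_mem_span_wordProd hb m₂ (fun i l hl => by simpa using Even.add_one hl) h

theorem wordProd_perm (hoff : ∀ i j, i ≠ j → QuadraticMap.polar Q (b i) (b j) = 0)
    {l l' : List I} (h : l.Perm l') :
    wordProd Q b l = wordProd Q b l' ∨ wordProd Q b l = -wordProd Q b l' := by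
  induction h with
  | nil => simp
  | cons i _ ih => rcases ih with h | h <;> simp [h]
  | swap i j l =>
    by_cases hij : i = j
    · subst hij; simp
    · right
      have h := ι_mul_ι_add_swap (Q := Q) (b j) (b i)
      rw [hoff j i (Ne.symm hij), map_zero] at h
      simp only [wordProd_cons, ← mul_assoc]
      rw [eq_neg_of_add_eq_zero_left h, neg_mul]
  | trans _ _ h1 h2 =>
    rcases h1 with h1 | h1 <;> rcases h2 with h2 | h2 <;> simp [h1, h2]

theorem ι_mul_wordProd_of_notMem (hoff : ∀ i j, i ≠ j → QuadraticMap.polar Q (b i) (b j) = 0)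
    {i : I} {l : List I} (hi : i ∉ l) :
    ι Q (b i) * wordProd Q b l = (-1 : ℤˣ) ^ l.length • (wordProd Q b l * ι Q (b i)) := by
  induction l with
  | nil => simp
  | cons j l ih =>
    rw [List.mem_cons, not_or] at hi
    have h := ι_mul_ι_add_swap (Q := Q) (b i) (b j)
    rw [hoff i j hi.1, map_zero] at h
    rw [wordProd_cons, ← mul_assoc, eq_neg_of_add_eq_zero_left h, neg_mul, mul_assoc, ih hi.2,
      mul_smul_comm, List.length_cons, pow_succ, mul_assoc]
    simp

theorem ι_mul_wordProd (hoff : ∀ i j, i ≠ j → QuadraticMap.polar Q (b i) (b j) = 0)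
    (i : I) (l : List I) :
    ι Q (b i) * wordProd Q b l = wordProd Q b l * ι Q (b i) ∨
      ι Q (b i) * wordProd Q b l = -(wordProd Q b l * ι Q (b i)) := by
  induction l with
  | nil => simp
  | cons j l ih =>
    have key : ι Q (b i) * ι Q (b j) = ι Q (b j) * ι Q (b i) ∨
        ι Q (b i) * ι Q (b j) = -(ι Q (b j) * ι Q (b i)) := by
      by_cases hij : i = j
      · subst hij; simp
      · have h := ι_mul_ι_add_swap (Q := Q) (b i) (b j)
        rw [hoff i j hij, map_zero] at h
        exact Or.inr (eq_neg_of_add_eq_zero_left h)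
    rw [wordProd_cons, ← mul_assoc]
    rcases key with h | h <;> rcases ih with h' | h' <;> simp [h, h', mul_assoc]

/-- Two equal letters can be brought together up to sign and replaced by the unit `Q (b i)`, which
shortens the word. A nonempty even word without repetition anticommutes with its first letter; as it
also commutes with it, `2 Q (b i)` kills its tail and the word is zero. -/
theorem wordProd_mem_range_algebraMap (h2 : IsUnit (2 : R)) (hu : ∀ i, IsUnit (Q (b i)))
    (hoff : ∀ i j, i ≠ j → QuadraticMap.polar Q (b i) (b j) = 0) (n : ℕ) :
    ∀ l : List I, l.length = n → Even l.length →
      (∀ i, ι Q (b i) * wordProd Q b l = wordProd Q b l * ι Q (b i)) →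
      ∃ r : R, wordProd Q b l = algebraMap R _ r := by
  induction n using Nat.strong_induction_on with
  | _ n ih =>
    intro l hln hl hc
    by_cases hd : l.Nodup
    · cases l with
      | nil => exact ⟨1, by simp⟩
      | cons i t =>
        have hodd : Odd t.length := by
          rw [List.length_cons] at hl
          exact Nat.not_even_iff_odd.1 (fun h => by simp [Nat.even_add_one, h] at hl)
        have h1 := ι_mul_wordProd_of_notMem (Q := Q) hoff (List.nodup_cons.1 hd).1
        rw [hodd.neg_one_pow, Units.neg_smul, one_smul] at h1
        have h3 := hc i
        have h4 : ι Q (b i) * (ι Q (b i) * wordProd Q b t) = Q (b i) • wordProd Q b t := by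
          rw [← mul_assoc, ι_sq_scalar, Algebra.smul_def]
        rw [wordProd_cons, mul_assoc, ← neg_eq_iff_eq_neg.2 h1, mul_neg, h4,
          eq_neg_iff_add_eq_zero, ← two_smul R, smul_smul] at h3
        have h5 := ((h2.mul (hu i)).smul_eq_zero).1 h3
        exact ⟨0, by rw [wordProd_cons, h5, mul_zero, map_zero]⟩
    · obtain ⟨i, hi⟩ := List.exists_duplicate_iff_not_nodup.2 hd
      obtain ⟨t, ht⟩ := (List.duplicate_iff_sublist.1 hi).exists_perm_append
      have hlen := ht.length_eq
      simp only [List.length_append, List.length_cons, List.length_nil] at hlen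
      obtain ⟨q, hq⟩ := hu i
      have hw : wordProd Q b ([i, i] ++ t) = (q : R) • wordProd Q b t := by
        simp only [List.cons_append, List.nil_append, wordProd_cons]
        rw [← mul_assoc, ι_sq_scalar, ← hq, Algebra.smul_def]
      have hw' : ∃ s : Rˣ, wordProd Q b l = (s : R) • wordProd Q b t := by
        rcases wordProd_perm hoff ht with h | h
        · exact ⟨q, by rw [h, hw]⟩
        · exact ⟨-q, by rw [h, hw]; simp⟩
      obtain ⟨s, hs⟩ := hw'
      have hct : ∀ j, ι Q (b j) * wordProd Q b t = wordProd Q b t * ι Q (b j) := by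
        intro j
        have h := hc j
        rw [hs, mul_smul_comm, smul_mul_assoc] at h
        exact (s.isUnit.smul_left_cancel).1 h
      obtain ⟨r, hr⟩ := ih t.length (by omega) t rfl (by
        rw [hlen] at hl; simpa [Nat.even_add] using hl) hct
      exact ⟨s * r, by rw [hs, hr, map_mul, Algebra.smul_def]⟩

/-- Even elements that commute with all vectors are scalars. -/
theorem mem_range_algebraMap_of_mem_even [Finite I] (h2 : IsUnit (2 : R))
    (hb : Submodule.span R (Set.range b) = ⊤) (hu : ∀ i, IsUnit (Q (b i)))
    (hoff : ∀ i j, i ≠ j → QuadraticMap.polar Q (b i) (b j) = 0)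
    {x : CliffordAlgebra Q} (hx : x ∈ even Q) (hc : ∀ m, ι Q m * x = x * ι Q m) :
    ∃ r : R, x = algebraMap R _ r := by
  classical
  have := Fintype.ofFinite I
  obtain ⟨c, hc2⟩ := h2.exists_left_inv
  have key : ∀ s : Finset I, x ∈ Submodule.span R (wordProd Q b '' {l | Even l.length ∧
      ∀ i ∈ s, ι Q (b i) * wordProd Q b l = wordProd Q b l * ι Q (b i)}) := by
    intro s
    induction s using Finset.induction_on with
    | empty => simpa using mem_span_wordProd_of_mem_even hb hx
    | insert i s _ ih =>
      obtain ⟨q, hq⟩ := hu i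
      -- Averaging `y` with its conjugate by `b i` is a projection: it fixes what commutes with `b
      -- i`, in particular `x`, and kills the words that anticommute with it.
      let π : CliffordAlgebra Q →ₗ[R] CliffordAlgebra Q :=
        c • (LinearMap.id + ((q⁻¹ : Rˣ) : R) • (LinearMap.mulLeft R (ι Q (b i)) ∘ₗ
          LinearMap.mulRight R (ι Q (b i))))
      have hπ : ∀ y, π y = c • (y + ((q⁻¹ : Rˣ) : R) • (ι Q (b i) * (y * ι Q (b i)))) :=
        fun y => rfl
      have hcomm : ∀ y, ι Q (b i) * y = y * ι Q (b i) → π y = y := by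
        intro y hy
        rw [hπ, ← hy, ← mul_assoc, ι_sq_scalar, ← hq, ← Algebra.smul_def, smul_smul,
          Units.inv_mul, one_smul, ← two_smul R y, smul_smul, hc2, one_smul]
      have hanti : ∀ y, ι Q (b i) * y = -(y * ι Q (b i)) → π y = 0 := by
        intro y hy
        rw [hπ, ← mul_assoc, hy, neg_mul, mul_assoc, ι_sq_scalar, ← Algebra.commutes, ← hq,
          ← Algebra.smul_def, smul_neg, smul_smul, Units.inv_mul, one_smul, add_neg_cancel,
          smul_zero]
      rw [← hcomm x (hc _)]
      refine (Submodule.map_span_le π _ _).2 ?_ (Submodule.mem_map_of_mem ih)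
      rintro _ ⟨l, ⟨hl, hl'⟩, rfl⟩
      rcases ι_mul_wordProd (Q := Q) hoff i l with h | h
      · rw [hcomm _ h]
        refine Submodule.subset_span ⟨l, ⟨hl, ?_⟩, rfl⟩
        intro j hj
        rcases Finset.mem_insert.1 hj with rfl | hj
        · exact h
        · exact hl' j hj
      · rw [hanti _ h]; exact zero_mem _
  have hle : Submodule.span R (wordProd Q b '' {l | Even l.length ∧
      ∀ i ∈ Finset.univ, ι Q (b i) * wordProd Q b l = wordProd Q b l * ι Q (b i)}) ≤
      LinearMap.range (Algebra.linearMap R (CliffordAlgebra Q)) := by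
    rw [Submodule.span_le]
    rintro _ ⟨l, ⟨hl, hl'⟩, rfl⟩
    obtain ⟨r, hr⟩ := wordProd_mem_range_algebraMap h2 hu hoff _ l rfl hl
      (fun i => hl' i (Finset.mem_univ i))
    exact ⟨r, hr.symm⟩
  obtain ⟨r, hr⟩ := hle (key Finset.univ)
  exact ⟨r, hr.symm⟩

/-- The spinor norm takes scalar values. -/
theorem exists_spinorNorm_eq_algebraMap [Finite I] (h2 : IsUnit (2 : R))
    (hb : Submodule.span R (Set.range b) = ⊤) (hu : ∀ i, IsUnit (Q (b i)))
    (hoff : ∀ i j, i ≠ j → QuadraticMap.polar Q (b i) (b j) = 0) (g : GSpin Q) :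
    ∃ r : R, spinorNorm g = algebraMap R _ r := by
  obtain ⟨g, hmem, hconj⟩ := g
  -- The vector `g m g⁻¹` equals its own reversal. Comparing the two expressions shows that `reverse
  -- g * g` commutes with all vectors, and it is even, hence scalar.
  have hrev : ∀ m, reverse (g⁻¹ : (CliffordAlgebra Q)ˣ).1 * ι Q m * reverse g.1 =
      g.1 * ι Q m * (g⁻¹ : (CliffordAlgebra Q)ˣ).1 := by
    intro m
    obtain ⟨m', hm'⟩ := (hconj (ι Q m)).1 ⟨m, rfl⟩
    have h := congrArg reverse hm'
    rw [reverse_ι, hm', reverse.map_mul, reverse.map_mul, reverse_ι, ← mul_assoc] at h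
    exact h.symm
  have hinv : reverse g.1 * reverse (g⁻¹ : (CliffordAlgebra Q)ˣ).1 = 1 := by
    rw [← reverse.map_mul, Units.inv_mul, reverse.map_one]
  have heven : reverse g.1 * g.1 ∈ even Q :=
    mul_mem ((reverse_mem_evenOdd_iff Q).2 hmem.1) hmem.1
  obtain ⟨r, hr⟩ := mem_range_algebraMap_of_mem_even h2 hb hu hoff heven fun m => by
    have h := congrArg (fun z => reverse g.1 * z * g.1) (hrev m)
    simp only [mul_assoc, Units.inv_mul, mul_one] at h
    rw [← mul_assoc, hinv, one_mul] at h
    rw [h, mul_assoc]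
  refine ⟨r, ?_⟩
  have h : reverse g.1 = algebraMap R _ r * (g⁻¹ : (CliffordAlgebra Q)ˣ).1 := by
    rw [← hr, mul_assoc, Units.mul_inv, mul_one]
  change g.1 * reverse g.1 = _
  rw [h, Algebra.commutes, ← mul_assoc, Units.mul_inv, one_mul]

end Words

end GeneralSpin

/-! ### The torus attached to a hyperbolic pair. -/

namespace GeneralSpin

open CliffordAlgebra

variable {R M : Type*} [CommRing R] [AddCommGroup M] [Module R M] (Q : QuadraticForm R M)

section HyperbolicTorus

/-- The element `d e f` of the even Clifford algebra; it is idempotent if `Q e = Q f = 0` and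
`d (e, f) = 1`. -/
def hyperbolicIdempotent (d : R) (e f : M) : CliffordAlgebra Q := d • (ι Q e * ι Q f)

/-- Isotropic vectors `e` and `f` with `d (e, f) = 1`. -/
structure IsHyperbolicPair (d : R) (e f : M) : Prop where
  isotropic_left : Q e = 0
  isotropic_right : Q f = 0
  polar_eq : d * QuadraticMap.polar Q e f = 1

variable {Q} {d : R} {e f : M}

theorem IsHyperbolicPair.symm (h : IsHyperbolicPair Q d e f) : IsHyperbolicPair Q d f e :=
  ⟨h.2, h.1, by rw [QuadraticMap.polar_comm, h.3]⟩

theorem IsHyperbolicPair.ι_left_mul_self (h : IsHyperbolicPair Q d e f) :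
    ι Q e * ι Q e = 0 := by
  rw [ι_sq_scalar, h.isotropic_left, map_zero]

theorem IsHyperbolicPair.idempotent_add (h : IsHyperbolicPair Q d e f) :
    hyperbolicIdempotent Q d e f + hyperbolicIdempotent Q d f e = 1 := by
  rw [hyperbolicIdempotent, hyperbolicIdempotent, ← smul_add, ι_mul_ι_add_swap,
    Algebra.smul_def, ← map_mul, h.polar_eq, map_one]

theorem IsHyperbolicPair.idempotent_mul_swap (h : IsHyperbolicPair Q d e f) :
    hyperbolicIdempotent Q d e f * hyperbolicIdempotent Q d f e = 0 := by
  rw [hyperbolicIdempotent, hyperbolicIdempotent, smul_mul_smul_comm, mul_assoc,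
    ← mul_assoc (ι Q f), h.symm.ι_left_mul_self, zero_mul, mul_zero, smul_zero]

theorem IsHyperbolicPair.idempotent_mul_self (h : IsHyperbolicPair Q d e f) :
    hyperbolicIdempotent Q d e f * hyperbolicIdempotent Q d e f =
      hyperbolicIdempotent Q d e f := by
  have h1 := congrArg (hyperbolicIdempotent Q d e f * ·) h.idempotent_add
  simpa [mul_add, h.idempotent_mul_swap] using h1

theorem reverse_hyperbolicIdempotent :
    reverse (hyperbolicIdempotent Q d e f) = hyperbolicIdempotent Q d f e := by
  simp [hyperbolicIdempotent]

theorem hyperbolicIdempotent_mem_even : hyperbolicIdempotent Q d e f ∈ even Q :=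
  Subalgebra.smul_mem _ (ι_mul_ι_mem_evenOdd_zero Q e f) d

/-- The element `p + u p'` for a unit `u`, where `p` and `p'` are the complementary idempotents
of a hyperbolic pair. -/
def hyperbolicUnit (h : IsHyperbolicPair Q d e f) (u : Rˣ) : (CliffordAlgebra Q)ˣ where
  val := hyperbolicIdempotent Q d e f + (u : R) • hyperbolicIdempotent Q d f e
  inv := hyperbolicIdempotent Q d e f + ((u⁻¹ : Rˣ) : R) • hyperbolicIdempotent Q d f e
  val_inv := by
    simp [add_mul, mul_add, h.idempotent_mul_self, h.symm.idempotent_mul_self,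
      h.idempotent_mul_swap, h.symm.idempotent_mul_swap, smul_smul, h.idempotent_add]
  inv_val := by
    simp [add_mul, mul_add, h.idempotent_mul_self, h.symm.idempotent_mul_self,
      h.idempotent_mul_swap, h.symm.idempotent_mul_swap, smul_smul, h.idempotent_add]

theorem hyperbolicUnit_inv (h : IsHyperbolicPair Q d e f) (u : Rˣ) :
    (hyperbolicUnit h u)⁻¹ = hyperbolicUnit h u⁻¹ := by
  ext; rfl

theorem val_hyperbolicUnit (h : IsHyperbolicPair Q d e f) (u : Rˣ) :
    (hyperbolicUnit h u : CliffordAlgebra Q) =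
      hyperbolicIdempotent Q d e f + (u : R) • hyperbolicIdempotent Q d f e := rfl

theorem hyperbolicUnit_mul_reverse (h : IsHyperbolicPair Q d e f) (u : Rˣ) :
    (hyperbolicUnit h u : CliffordAlgebra Q) * reverse (hyperbolicUnit h u : CliffordAlgebra Q) =
      algebraMap R _ u := by
  rw [val_hyperbolicUnit, map_add, map_smul, reverse_hyperbolicIdempotent,
    reverse_hyperbolicIdempotent]
  simp only [add_mul, mul_add, h.idempotent_mul_self, h.symm.idempotent_mul_self,
    h.idempotent_mul_swap, h.symm.idempotent_mul_swap, smul_mul_assoc, mul_smul_comm, smul_zero,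
    zero_add, add_zero]
  rw [← smul_add, h.symm.idempotent_add, Algebra.algebraMap_eq_smul_one]

/-- The image of `x` under conjugation with `hyperbolicUnit h u`. -/
def hyperbolicTransform (Q : QuadraticForm R M) (d : R) (e f : M) (u : Rˣ) (x : M) : M :=
  x + ((((u⁻¹ : Rˣ) : R) - 1) * (d * QuadraticMap.polar Q x f)) • e +
    (((u : R) - 1) * (d * QuadraticMap.polar Q x e)) • f

theorem val_hyperbolicUnit_eq_one_add (h : IsHyperbolicPair Q d e f) (u : Rˣ) :
    (hyperbolicUnit h u : CliffordAlgebra Q) = 1 + (((u : R) - 1) * d) • (ι Q f * ι Q e) := by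
  rw [val_hyperbolicUnit, ← h.idempotent_add, mul_smul, sub_smul, one_smul]
  simp only [hyperbolicIdempotent]
  abel

/-- The form of `hyperbolicTransform` matters: its coefficients involve only `u`, `u⁻¹`, `d (x, e)`
and `d (x, f)`, so for an integral unit `u` it visibly preserves any lattice that contains `e, f`
and on which `d (·, ·)` is integral. -/
theorem hyperbolicUnit_conj (h : IsHyperbolicPair Q d e f) (u : Rˣ) (x : M) :
    (hyperbolicUnit h u : CliffordAlgebra Q) * ι Q x *
      ((hyperbolicUnit h u)⁻¹ : (CliffordAlgebra Q)ˣ) =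
        ι Q (hyperbolicTransform Q d e f u x) := by
  have hcomm : ι Q f * ι Q e * ι Q x = ι Q x * (ι Q f * ι Q e) +
      QuadraticMap.polar Q x e • ι Q f - QuadraticMap.polar Q x f • ι Q e := by
    have h1 := ι_mul_ι_add_swap (Q := Q) x f
    have h2 := ι_mul_ι_add_swap (Q := Q) x e
    rw [← mul_assoc, eq_sub_of_add_eq h1, mul_assoc, eq_sub_of_add_eq' h2, Algebra.smul_def,
      Algebra.smul_def, sub_mul, mul_sub, ← Algebra.commutes, ← mul_assoc]
    abel
  have he : ι Q e * (ι Q f * ι Q e) = QuadraticMap.polar Q e f • ι Q e := by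
    rw [← mul_assoc, eq_sub_of_add_eq (ι_mul_ι_add_swap (Q := Q) e f), sub_mul, mul_assoc,
      h.ι_left_mul_self, mul_zero, sub_zero, Algebra.smul_def]
  have hf : ι Q f * (ι Q f * ι Q e) = 0 := by
    rw [← mul_assoc, h.symm.ι_left_mul_self, zero_mul]
  have hu : ((u⁻¹ : Rˣ) : R) * u = 1 := Units.inv_mul u
  rw [Units.mul_inv_eq_iff_eq_mul, val_hyperbolicUnit_eq_one_add, add_mul, one_mul, smul_mul_assoc,
    hcomm, hyperbolicTransform, map_add, map_add, map_smul, map_smul]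
  simp only [mul_add, add_mul, mul_one, mul_smul_comm, smul_mul_assoc, he, hf, smul_zero,
    smul_add, smul_sub, smul_smul, add_zero]
  have hcoef : (u - 1) * d * (((u⁻¹ : Rˣ) : R) - 1) * (d * QuadraticMap.polar Q x f) *
      QuadraticMap.polar Q e f + (((u⁻¹ : Rˣ) : R) - 1) * (d * QuadraticMap.polar Q x f) =
        -((u - 1) * d * QuadraticMap.polar Q x f) := by
    linear_combination ((u - 1) * (((u⁻¹ : Rˣ) : R) - 1) * (d * QuadraticMap.polar Q x f)) *
      h.polar_eq + (d * QuadraticMap.polar Q x f) * hu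
  linear_combination (norm := module) -(congrArg (· • ι Q e) hcoef)

theorem hyperbolicUnit_mem_GSpin (h : IsHyperbolicPair Q d e f) (u : Rˣ) :
    hyperbolicUnit h u ∈ GSpin Q := by
  have hmem : ∀ u : Rˣ, (hyperbolicUnit h u : CliffordAlgebra Q) ∈ even Q := fun u =>
    add_mem hyperbolicIdempotent_mem_even (Subalgebra.smul_mem _ hyperbolicIdempotent_mem_even _)
  refine ⟨⟨hmem u, hmem u⁻¹⟩, fun x => ⟨?_, ?_⟩⟩
  · rintro ⟨m, rfl⟩
    exact ⟨_, (hyperbolicUnit_conj h u m).symm⟩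
  · rintro ⟨m, hm⟩
    refine ⟨hyperbolicTransform Q d e f u⁻¹ m, ?_⟩
    rw [← hyperbolicUnit_conj h, hm, hyperbolicUnit_inv, ← hyperbolicUnit_inv, inv_inv]
    simp [mul_assoc]

end HyperbolicTorus

end GeneralSpin

/-! ### Topology of the general spin group and compact open stabilizers. -/

namespace GeneralSpin

open CliffordAlgebra Module

variable {R M : Type*} [CommRing R] [AddCommGroup M] [Module R M] {Q : QuadraticForm R M}

section Parts

variable [Invertible (2 : R)]

variable (Q) in
/-- The vector part of an element of the Clifford algebra. -/
noncomputable def vectorPart : CliffordAlgebra Q →ₗ[R] M :=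
  ExteriorAlgebra.ιInv ∘ₗ (equivExterior Q).toLinearMap

variable (Q) in
/-- The scalar part of an element of the Clifford algebra. -/
noncomputable def scalarPart : CliffordAlgebra Q →ₗ[R] R :=
  ExteriorAlgebra.algebraMapInv.toLinearMap ∘ₗ (equivExterior Q).toLinearMap

@[simp] theorem vectorPart_ι (m : M) : vectorPart Q (ι Q m) = m := by
  have h : equivExterior Q (ι Q m) = ExteriorAlgebra.ι R m :=
    changeForm_ι changeForm.associated_neg_proof m
  rw [vectorPart, LinearMap.comp_apply, LinearEquiv.coe_coe, h]
  exact ExteriorAlgebra.ι_leftInverse m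

@[simp] theorem scalarPart_algebraMap (r : R) :
    scalarPart Q (algebraMap R (CliffordAlgebra Q) r) = r := by
  have h : equivExterior Q (algebraMap R (CliffordAlgebra Q) r) = algebraMap R _ r :=
    changeForm_algebraMap changeForm.associated_neg_proof r
  rw [scalarPart, LinearMap.comp_apply, LinearEquiv.coe_coe, h]
  exact ExteriorAlgebra.algebraMap_leftInverse M r

theorem mem_even_iff_involute_eq {x : CliffordAlgebra Q} : x ∈ even Q ↔ involute x = x := by
  refine ⟨fun h => involute_eq_of_mem_even h, fun h => ?_⟩
  obtain ⟨y, hy, z, hz, rfl⟩ := Submodule.mem_sup.1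
    ((evenOdd_isCompl Q).sup_eq_top ▸ Submodule.mem_top : x ∈ evenOdd Q 0 ⊔ evenOdd Q 1)
  rw [map_add, involute_eq_of_mem_even hy, involute_eq_of_mem_odd hz, add_right_inj,
    neg_eq_iff_add_eq_zero, ← two_smul R] at h
  have hz0 : z = 0 := (isUnit_of_invertible (2 : R)).smul_eq_zero.1 h
  rw [hz0, add_zero]
  exact hy

theorem mem_range_ι_iff {x : CliffordAlgebra Q} :
    x ∈ LinearMap.range (ι Q) ↔ ι Q (vectorPart Q x) = x :=
  ⟨by rintro ⟨m, rfl⟩; rw [vectorPart_ι], fun h => ⟨_, h⟩⟩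

theorem act_eq_iff {g : GSpin Q} {m m' : M} :
    act g m = m' ↔ ι Q m' = g.1.1 * ι Q m * (g.1⁻¹ : (CliffordAlgebra Q)ˣ).1 := by
  rw [← ι_act]
  exact ⟨fun h => by rw [h], fun h => by simpa using (congrArg (vectorPart Q) h).symm⟩

theorem act_eq_vectorPart (g : GSpin Q) (m : M) :
    act g m = vectorPart Q (g.1.1 * ι Q m * (g.1⁻¹ : (CliffordAlgebra Q)ˣ).1) := by
  rw [← ι_act, vectorPart_ι]

theorem act_mul (g h : GSpin Q) (m : M) : act (g * h) m = act g (act h m) := by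
  rw [act_eq_iff, ι_act, ι_act]
  simp [mul_assoc]

theorem act_one (m : M) : act (1 : GSpin Q) m = m := by
  rw [act_eq_iff]; simp

end Parts

theorem spinorNorm_mul_of_eq {g h : GSpin Q} {r s : R} (hg : spinorNorm g = algebraMap R _ r)
    (hh : spinorNorm h = algebraMap R _ s) : spinorNorm (g * h) = algebraMap R _ (r * s) := by
  have hh' : h.1.1 * reverse h.1.1 = algebraMap R _ s := hh
  have hg' : g.1.1 * reverse g.1.1 = algebraMap R _ r := hg
  change g.1.1 * h.1.1 * reverse (g.1.1 * h.1.1) = _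
  rw [reverse.map_mul, mul_assoc, ← mul_assoc h.1.1, hh', Algebra.commutes, ← mul_assoc, hg',
    map_mul]

theorem spinorNorm_one : spinorNorm (1 : GSpin Q) = 1 := by
  simp [spinorNorm]

section Topology

theorem isCompact_of_fg [TopologicalSpace R] [TopologicalSpace M] [ContinuousAdd M] [ContinuousSMul R M]
    {S : Subring R} (hS : IsCompact (S : Set R)) {N : Submodule S M} (hN : N.FG) :
    IsCompact (N : Set M) := by
  obtain ⟨n, v, hv⟩ := Submodule.fg_iff_exists_fin_generating_family.1 hN
  have : CompactSpace S := isCompact_iff_compactSpace.1 hS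
  have hcont : Continuous fun c : Fin n → S => ∑ i, (c i : R) • v i := by fun_prop
  have h := isCompact_range hcont
  have heq : Set.range (fun c : Fin n → S => ∑ i, (c i : R) • v i) = (N : Set M) := by
    rw [← hv, ← Fintype.range_linearCombination S]
    rfl
  rwa [heq] at h

theorem isOpen_setOf_forall_mem {X Y Z : Type*} [TopologicalSpace X] [TopologicalSpace Y]
    [TopologicalSpace Z] {φ : X × Y → Z} (hφ : Continuous φ) {K : Set Y} (hK : IsCompact K)
    {U : Set Z} (hU : IsOpen U) : IsOpen {x | ∀ y ∈ K, φ (x, y) ∈ U} := by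
  rw [isOpen_iff_eventually]
  intro x hx
  exact hK.eventually_forall_of_forall_eventually fun y hy =>
    hφ.continuousAt.eventually_mem (hU.mem_nhds (hx y hy))

/-- A submodule containing a basis is open. -/
theorem isOpen_preimage_of_basis_mem {C ι' : Type*} [Finite ι'] [AddCommGroup C] [Module R C]
    [TopologicalSpace R] [IsTopologicalRing R]
    [TopologicalSpace C] [IsModuleTopology R C] {S : Subring R}
    (hS : IsOpen (S : Set R)) (B : Basis ι' R M) (φ : C →ₗ[R] M) {N : Submodule S M}
    (hN : ∀ i, B i ∈ N) : IsOpen (φ ⁻¹' (N : Set M)) := by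
  have := Fintype.ofFinite ι'
  have := IsModuleTopology.topologicalAddGroup R C
  have hU : IsOpen {x : C | ∀ i, B.repr (φ x) i ∈ S} := by
    rw [Set.ofPred_forall]
    refine isOpen_iInter_of_finite fun i => hS.preimage ?_
    exact IsModuleTopology.continuous_of_linearMap (B.coord i ∘ₗ φ)
  have hsub : {x : C | ∀ i, B.repr (φ x) i ∈ S} ⊆ φ ⁻¹' (N : Set M) := by
    intro x hx
    rw [Set.mem_preimage, ← B.sum_repr (φ x)]
    exact sum_mem fun i _ => N.smul_mem ⟨_, hx i⟩ (hN i)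
  let A : AddSubgroup C := N.toAddSubgroup.comap φ.toAddMonoidHom
  exact A.isOpen_of_mem_nhds (g := 0) (Filter.mem_of_superset (hU.mem_nhds (by simp)) hsub)

variable [Invertible (2 : R)]

variable (Q) in
theorem finite_cliffordAlgebra {n : ℕ} (b : Basis (Fin n) R M) :
    Module.Finite R (CliffordAlgebra Q) :=
  Module.Finite.of_basis (b.ExteriorAlgebra.map (equivExterior Q).symm)

theorem t2Space_cliffordAlgebra [TopologicalSpace R] [IsTopologicalRing R]
    [TopologicalSpace (CliffordAlgebra Q)] [IsModuleTopology R (CliffordAlgebra Q)] [T2Space R] {n : ℕ} (b : Basis (Fin n) R M) :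
    T2Space (CliffordAlgebra Q) := by
  let B := b.ExteriorAlgebra.map (equivExterior Q).symm
  exact T2Space.of_injective_continuous B.equivFun.injective
    (IsModuleTopology.continuous_of_linearMap B.equivFun.toLinearMap)

variable [TopologicalSpace R] [TopologicalSpace (CliffordAlgebra Q)]
  [IsModuleTopology R (CliffordAlgebra Q)]

/-- Being even or being a vector is the fixed-point condition of a continuous linear map, `involute`
or `ι ∘ vectorPart`, hence closed. -/
theorem isClosed_GSpin [T2Space (CliffordAlgebra Q)] [IsTopologicalRing (CliffordAlgebra Q)] :
    IsClosed (GSpin Q : Set (CliffordAlgebra Q)ˣ) := by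
  have hinv : Continuous fun x : CliffordAlgebra Q => involute x :=
    IsModuleTopology.continuous_of_linearMap
      (involute : CliffordAlgebra Q →ₐ[R] CliffordAlgebra Q).toLinearMap
  have hvec : Continuous fun x : CliffordAlgebra Q => ι Q (vectorPart Q x) :=
    IsModuleTopology.continuous_of_linearMap (ι Q ∘ₗ vectorPart Q)
  have heven : IsClosed (even Q : Set (CliffordAlgebra Q)) := by
    have : (even Q : Set (CliffordAlgebra Q)) = {x | involute x = x} :=
      Set.ext fun x => mem_even_iff_involute_eq
    rw [this]
    exact isClosed_eq hinv continuous_id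
  have hran : IsClosed (LinearMap.range (ι Q) : Set (CliffordAlgebra Q)) := by
    have : (LinearMap.range (ι Q) : Set (CliffordAlgebra Q)) = {x | ι Q (vectorPart Q x) = x} :=
      Set.ext fun x => mem_range_ι_iff
    rw [this]
    exact isClosed_eq hvec continuous_id
  have hval : Continuous fun g : (CliffordAlgebra Q)ˣ => g.1 := Units.continuous_val
  have hval' : Continuous fun g : (CliffordAlgebra Q)ˣ => (g⁻¹).1 := Units.continuous_coe_inv
  have heq : (GSpin Q : Set (CliffordAlgebra Q)ˣ) =
      {g | g.1 ∈ (even Q : Set (CliffordAlgebra Q))} ∩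
      ({g | (g⁻¹).1 ∈ (even Q : Set (CliffordAlgebra Q))} ∩
      ((⋂ m : M, {g | g.1 * ι Q m * (g⁻¹).1 ∈ (LinearMap.range (ι Q) : Set _)}) ∩
      (⋂ m : M, {g | (g⁻¹).1 * ι Q m * g.1 ∈ (LinearMap.range (ι Q) : Set _)}))) := by
    ext g
    simp only [Set.mem_inter_iff, Set.mem_iInter, Set.mem_ofPred_eq, SetLike.mem_coe]
    constructor
    · intro hg
      refine ⟨hg.1.1, hg.1.2, fun m => (hg.2 _).1 ⟨m, rfl⟩, fun m => ?_⟩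
      simpa using ((inv_mem hg).2 (ι Q m)).1 ⟨m, rfl⟩
    · rintro ⟨h1, h2, h3, h4⟩
      refine ⟨⟨h1, h2⟩, fun x => ⟨?_, ?_⟩⟩
      · rintro ⟨m, rfl⟩
        exact h3 m
      · rintro ⟨m, hm⟩
        have h := h4 m
        rw [hm] at h
        simpa [mul_assoc] using h
  rw [heq]
  refine (heven.preimage hval).inter ((heven.preimage hval').inter (IsClosed.inter ?_ ?_))
  · exact isClosed_iInter fun m => hran.preimage ((hval.mul continuous_const).mul hval')
  · exact isClosed_iInter fun m => hran.preimage ((hval'.mul continuous_const).mul hval)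

end Topology

section Stabilizer

variable [Invertible (2 : R)] (S : Subring R)

/-- The elements `g` of `GSpin Q` that preserve a submodule `N` of vectors, preserve a
submodule `Λ` of the Clifford algebra under left multiplication, and have integral spinor norm,
together with `g⁻¹`. -/
def stabilizer (hscalar : ∀ g : GSpin Q, ∃ r : R, spinorNorm g = algebraMap R _ r)
    (N : Submodule S M) (Λ : Submodule S (CliffordAlgebra Q)) : Subgroup (GSpin Q) :=
  let T : Submonoid (GSpin Q) :=
    { carrier := {g | (∀ x ∈ N, act g x ∈ N) ∧ (∀ x ∈ Λ, g.1.1 * x ∈ Λ) ∧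
        scalarPart Q (spinorNorm g) ∈ S}
      one_mem' := ⟨fun x hx => by rwa [act_one], fun x hx => by simpa using hx, by
        rw [spinorNorm_one, ← map_one (algebraMap R _), scalarPart_algebraMap]
        exact one_mem S⟩
      mul_mem' := by
        rintro g h ⟨hg1, hg2, hg3⟩ ⟨hh1, hh2, hh3⟩
        refine ⟨fun x hx => ?_, fun x hx => ?_, ?_⟩
        · rw [act_mul]
          exact hg1 _ (hh1 x hx)
        · simpa [mul_assoc] using hg2 _ (hh2 x hx)
        -- `scalarPart` is only linear; the spinor norm is multiplicative because its values are
        -- scalars, hence central.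
        · obtain ⟨r, hr⟩ := hscalar g
          obtain ⟨s, hs⟩ := hscalar h
          rw [hr, scalarPart_algebraMap] at hg3
          rw [hs, scalarPart_algebraMap] at hh3
          rw [spinorNorm_mul_of_eq hr hs, scalarPart_algebraMap]
          exact mul_mem hg3 hh3 }
  { carrier := {g | g ∈ T ∧ g⁻¹ ∈ T}
    one_mem' := ⟨one_mem _, by simp⟩
    mul_mem' := fun {g h} hg hh => ⟨mul_mem hg.1 hh.1, by
      rw [mul_inv_rev]; exact mul_mem hh.2 hg.2⟩
    inv_mem' := fun {g} hg => ⟨hg.2, by simpa using hg.1⟩ }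

variable {S} {hscalar : ∀ g : GSpin Q, ∃ r : R, spinorNorm g = algebraMap R _ r}
  {N : Submodule S M} {Λ : Submodule S (CliffordAlgebra Q)}

theorem act_image_eq_of_mem_stabilizer {g : GSpin Q} (hg : g ∈ stabilizer S hscalar N Λ) :
    act g '' (N : Set M) = N := by
  refine Set.Subset.antisymm (Set.image_subset_iff.2 fun x hx => hg.1.1 x hx) fun x hx => ?_
  exact ⟨act g⁻¹ x, hg.2.1 x hx, by rw [← act_mul, mul_inv_cancel, act_one]⟩

/-- One inclusion holds because `g` and `g⁻¹` have integral spinor norms with product one; the other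
is realized by the elements `hyperbolicUnit h u`. -/
theorem spinorNorm_image_stabilizer {d : R} {e f : M} (h : IsHyperbolicPair Q d e f)
    (he : e ∈ N) (hf : f ∈ N) (hd : ∀ x ∈ N, ∀ y ∈ N, d * QuadraticMap.polar Q x y ∈ S)
    (hΛ : ∀ x ∈ Λ, hyperbolicIdempotent Q d e f * x ∈ Λ)
    (hΛ' : ∀ x ∈ Λ, hyperbolicIdempotent Q d f e * x ∈ Λ) :
    spinorNorm '' (stabilizer S hscalar N Λ : Set (GSpin Q)) =
      (fun u : Rˣ => algebraMap R (CliffordAlgebra Q) u) '' (S.toSubmonoid.units : Set Rˣ) := by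
  apply Set.Subset.antisymm
  · rintro _ ⟨g, hg, rfl⟩
    obtain ⟨r, hr⟩ := hscalar g
    obtain ⟨s, hs⟩ := hscalar g⁻¹
    have hrs : r * s = 1 := by
      have h1 := congrArg (scalarPart Q) (spinorNorm_mul_of_eq hr hs)
      rw [mul_inv_cancel, spinorNorm_one, ← map_one (algebraMap R _), scalarPart_algebraMap,
        scalarPart_algebraMap] at h1
      exact h1.symm
    have h1 := hg.1.2.2
    have h2 := hg.2.2.2
    rw [hr, scalarPart_algebraMap] at h1
    rw [hs, scalarPart_algebraMap] at h2
    exact ⟨⟨r, s, hrs, by rw [mul_comm, hrs]⟩, ⟨h1, h2⟩, hr.symm⟩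
  · rintro _ ⟨u, hu, rfl⟩
    have hT : ∀ u : Rˣ, u ∈ S.toSubmonoid.units →
        (∀ x ∈ N, act ⟨hyperbolicUnit h u, hyperbolicUnit_mem_GSpin h u⟩ x ∈ N) ∧
        (∀ x ∈ Λ, (hyperbolicUnit h u : CliffordAlgebra Q) * x ∈ Λ) ∧
        scalarPart Q (spinorNorm ⟨hyperbolicUnit h u, hyperbolicUnit_mem_GSpin h u⟩) ∈ S := by
      intro u hu
      refine ⟨fun x hx => ?_, fun x hx => ?_, ?_⟩
      · rw [act_eq_iff.2 (hyperbolicUnit_conj h u x).symm]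
        refine add_mem (add_mem hx ?_) ?_
        · exact N.smul_mem ⟨_, mul_mem (sub_mem hu.2 (one_mem S)) (hd x hx f hf)⟩ he
        · exact N.smul_mem ⟨_, mul_mem (sub_mem hu.1 (one_mem S)) (hd x hx e he)⟩ hf
      · rw [val_hyperbolicUnit, add_mul, smul_mul_assoc]
        exact add_mem (hΛ x hx) (Λ.smul_mem ⟨_, hu.1⟩ (hΛ' x hx))
      · have h1 : spinorNorm ⟨hyperbolicUnit h u, hyperbolicUnit_mem_GSpin h u⟩ =
          algebraMap R (CliffordAlgebra Q) u := hyperbolicUnit_mul_reverse h u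
        rw [h1, scalarPart_algebraMap]
        exact hu.1
    refine ⟨⟨hyperbolicUnit h u, hyperbolicUnit_mem_GSpin h u⟩, ⟨hT u hu, ?_⟩,
      hyperbolicUnit_mul_reverse h u⟩
    have h1 : (⟨hyperbolicUnit h u, hyperbolicUnit_mem_GSpin h u⟩ : GSpin Q)⁻¹ =
        ⟨hyperbolicUnit h u⁻¹, hyperbolicUnit_mem_GSpin h u⁻¹⟩ :=
      Subtype.ext (hyperbolicUnit_inv h u)
    rw [h1]
    exact hT u⁻¹ (inv_mem hu)

variable [TopologicalSpace R] [TopologicalSpace (CliffordAlgebra Q)]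
  [IsModuleTopology R (CliffordAlgebra Q)] [IsTopologicalRing (CliffordAlgebra Q)]

/-- Each lattice condition says that a jointly continuous map sends a compact set into an open one,
which is open in `g` by the tube lemma. -/
theorem isOpen_stabilizer [IsTopologicalRing R] (hSo : IsOpen (S : Set R)) (hN : IsCompact (ι Q '' (N : Set M)))
    (hNo : IsOpen (vectorPart Q ⁻¹' (N : Set M))) (hΛ : IsCompact (Λ : Set (CliffordAlgebra Q)))
    (hΛo : IsOpen (Λ : Set (CliffordAlgebra Q))) :
    IsOpen (stabilizer S hscalar N Λ : Set (GSpin Q)) := by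
  have hval : Continuous fun g : GSpin Q => g.1.1 :=
    Units.continuous_val.comp continuous_subtype_val
  have hval' : Continuous fun g : GSpin Q => (g.1⁻¹).1 :=
    Units.continuous_coe_inv.comp continuous_subtype_val
  have h1 : IsOpen {g : GSpin Q | ∀ x ∈ N, act g x ∈ N} := by
    have hφ : Continuous fun z : GSpin Q × CliffordAlgebra Q => z.1.1.1 * z.2 * (z.1.1⁻¹).1 :=
      ((hval.comp continuous_fst).mul continuous_snd).mul (hval'.comp continuous_fst)
    convert isOpen_setOf_forall_mem hφ hN hNo using 1
    ext g
    simp [act_eq_vectorPart]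
  have h2 : IsOpen {g : GSpin Q | ∀ x ∈ Λ, g.1.1 * x ∈ Λ} :=
    isOpen_setOf_forall_mem
      (φ := fun z : GSpin Q × CliffordAlgebra Q => z.1.1.1 * z.2)
      ((hval.comp continuous_fst).mul continuous_snd) hΛ hΛo
  have h3 : IsOpen {g : GSpin Q | scalarPart Q (spinorNorm g) ∈ S} := by
    refine hSo.preimage ((IsModuleTopology.continuous_of_linearMap (scalarPart Q)).comp ?_)
    exact hval.mul ((IsModuleTopology.continuous_of_linearMap (reverse (Q := Q))).comp hval)
  have hT := h1.inter (h2.inter h3)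
  exact hT.inter (hT.preimage continuous_inv)

/-- Since `1 ∈ Λ`, both `g` and `g⁻¹` lie in the compact set `Λ`. The units embed as a closed subset
by `g ↦ (g, g⁻¹)`, `GSpin` is closed in them, and an open subgroup is closed. -/
theorem isCompact_stabilizer [T2Space (CliffordAlgebra Q)]
    (hopen : IsOpen (stabilizer S hscalar N Λ : Set (GSpin Q)))
    (hΛ : IsCompact (Λ : Set (CliffordAlgebra Q))) (hΛ1 : 1 ∈ Λ) :
    IsCompact (stabilizer S hscalar N Λ : Set (GSpin Q)) := by
  have hj := Units.isClosedEmbedding_embedProduct.comp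
    (isClosed_GSpin (Q := Q)).isClosedEmbedding_subtypeVal
  have hc := hj.isCompact_preimage (hΛ.prod (hΛ.image MulOpposite.continuous_op))
  have hcl : IsClosed (stabilizer S hscalar N Λ : Set (GSpin Q)) :=
    Subgroup.isClosed_of_isOpen _ hopen
  refine hc.of_isClosed_subset hcl fun g hg => ?_
  refine ⟨by simpa using hg.1.2.1 1 hΛ1, ⟨(g.1⁻¹).1, by simpa using hg.2.2.1 1 hΛ1, rfl⟩⟩

end Stabilizer

section Existence

variable [Invertible (2 : R)] [TopologicalSpace R] [IsTopologicalRing R]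
  [TopologicalSpace (CliffordAlgebra Q)] [IsModuleTopology R (CliffordAlgebra Q)]

/-- For any lattice `Λ₀`, the sum `p Λ₀ + p' Λ₀` contains `Λ₀` because `p + p' = 1`, and is stable
under `p` and `p'` because they are orthogonal idempotents. -/
theorem exists_submodule_hyperbolicIdempotent_mul_mem {n : ℕ} (b : Basis (Fin n) R M)
    {S : Subring R} (hSo : IsOpen (S : Set R)) (hSc : IsCompact (S : Set R))
    {d : R} {e f : M} (h : IsHyperbolicPair Q d e f) :
    ∃ Λ : Submodule S (CliffordAlgebra Q), IsOpen (Λ : Set (CliffordAlgebra Q)) ∧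
      IsCompact (Λ : Set (CliffordAlgebra Q)) ∧ 1 ∈ Λ ∧
      (∀ x ∈ Λ, hyperbolicIdempotent Q d e f * x ∈ Λ) ∧
      ∀ x ∈ Λ, hyperbolicIdempotent Q d f e * x ∈ Λ := by
  let B := b.ExteriorAlgebra.map (equivExterior Q).symm
  have := IsModuleTopology.toContinuousAdd R (CliffordAlgebra Q)
  let Λ₀ : Submodule S (CliffordAlgebra Q) := Submodule.span S (insert 1 (Set.range B))
  have hΛ₀ : Λ₀.FG := Submodule.fg_span ((Set.finite_range B).insert 1)
  set p := hyperbolicIdempotent Q d e f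
  set p' := hyperbolicIdempotent Q d f e
  let Λ : Submodule S (CliffordAlgebra Q) :=
    Λ₀.map (LinearMap.mulLeft S p) ⊔ Λ₀.map (LinearMap.mulLeft S p')
  have hle : Λ₀ ≤ Λ := fun x hx => by
    rw [← one_mul x, ← h.idempotent_add, add_mul]
    exact add_mem (Submodule.mem_sup_left ⟨x, hx, rfl⟩) (Submodule.mem_sup_right ⟨x, hx, rfl⟩)
  refine ⟨Λ, ?_, isCompact_of_fg hSc ((hΛ₀.map _).sup (hΛ₀.map _)),
    hle (Submodule.subset_span (Set.mem_insert _ _)), fun x hx => ?_, fun x hx => ?_⟩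
  · exact isOpen_preimage_of_basis_mem hSo B LinearMap.id fun i =>
      hle (Submodule.subset_span (Set.mem_insert_of_mem _ ⟨i, rfl⟩))
  · obtain ⟨_, ⟨y, hy, rfl⟩, _, ⟨z, hz, rfl⟩, rfl⟩ := Submodule.mem_sup.1 hx
    refine Submodule.mem_sup_left ⟨y, hy, ?_⟩
    simp only [LinearMap.mulLeft_apply, mul_add, ← mul_assoc, p, p', h.idempotent_mul_self,
      h.idempotent_mul_swap, zero_mul, add_zero]
  · obtain ⟨_, ⟨y, hy, rfl⟩, _, ⟨z, hz, rfl⟩, rfl⟩ := Submodule.mem_sup.1 hx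
    refine Submodule.mem_sup_right ⟨z, hz, ?_⟩
    simp only [LinearMap.mulLeft_apply, mul_add, ← mul_assoc, p, p', h.symm.idempotent_mul_self,
      h.symm.idempotent_mul_swap, zero_mul, zero_add]

/-- If a lattice `N` in a quadratic space contains a hyperbolic pair, suitably normalized with
respect to the values of the form on `N`, then an open compact subgroup of the general spin group
stabilizes `N` and has as spinor norms exactly the units of the ring of integers `S`. -/
theorem exists_isOpen_isCompact_subgroup [T2Space R] {n : ℕ} (b : Basis (Fin n) R M)
    {S : Subring R} (hSo : IsOpen (S : Set R)) (hSc : IsCompact (S : Set R))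
    (hscalar : ∀ g : GSpin Q, ∃ r : R, spinorNorm g = algebraMap R _ r)
    {N : Submodule S M} (hN : N.FG) (hb : ∀ i, b i ∈ N)
    {d : R} {e f : M} (h : IsHyperbolicPair Q d e f) (he : e ∈ N) (hf : f ∈ N)
    (hd : ∀ x ∈ N, ∀ y ∈ N, d * QuadraticMap.polar Q x y ∈ S) :
    ∃ K : Subgroup (GSpin Q), IsOpen (K : Set (GSpin Q)) ∧ IsCompact (K : Set (GSpin Q)) ∧
      (∀ k ∈ K, act k '' (N : Set M) = N) ∧
      spinorNorm '' (K : Set (GSpin Q)) =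
        (fun u : Rˣ => algebraMap R (CliffordAlgebra Q) u) '' (S.toSubmonoid.units : Set Rˣ) := by
  have := finite_cliffordAlgebra Q b
  have := IsModuleTopology.isTopologicalRing R (CliffordAlgebra Q)
  have := t2Space_cliffordAlgebra (Q := Q) b
  obtain ⟨Λ, hΛo, hΛc, hΛ1, hΛ, hΛ'⟩ :=
    exists_submodule_hyperbolicIdempotent_mul_mem (Q := Q) b hSo hSc h
  have hιN : IsCompact (ι Q '' (N : Set M)) :=
    isCompact_of_fg hSc (hN.map ((ι Q).restrictScalars S))
  have hNo : IsOpen (vectorPart Q ⁻¹' (N : Set M)) :=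
    isOpen_preimage_of_basis_mem hSo b (vectorPart Q) hb
  have hopen := isOpen_stabilizer (hscalar := hscalar) hSo hιN hNo hΛc hΛo
  exact ⟨stabilizer S hscalar N Λ, hopen, isCompact_stabilizer hopen hΛc hΛ1,
    fun _ hk => act_image_eq_of_mem_stabilizer hk,
    spinorNorm_image_stabilizer h he hf hd hΛ hΛ'⟩

end Existence

end GeneralSpin

/-! ### Ternary forms over finite fields, and reduction of lattices. -/

section ResidualReduction

open Module

/-- By Chevalley–Warning (degree two, three variables) the characteristic divides the number of
zeros, so the trivial zero is not the only one. -/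
theorem exists_ternary_zero {k : Type*} [Field k] [Finite k] (a : Fin 3 → Fin 3 → k) :
    ∃ x : Fin 3 → k, x ≠ 0 ∧ ∑ i, ∑ j, a i j * (x i * x j) = 0 := by
  classical
  have := Fintype.ofFinite k
  obtain ⟨p, hp⟩ := CharP.exists k
  have hp' : p.Prime := (CharP.char_is_prime_or_zero k p).resolve_right
    (CharP.char_ne_zero_of_finite k p)
  let f : MvPolynomial (Fin 3) k := ∑ i, ∑ j, MvPolynomial.C (a i j) *
    (MvPolynomial.X i * MvPolynomial.X j)
  have hf : f.totalDegree < Fintype.card (Fin 3) := by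
    refine lt_of_le_of_lt (b := 2) ?_ (by simp)
    refine MvPolynomial.totalDegree_finsetSum_le fun i _ =>
      MvPolynomial.totalDegree_finsetSum_le fun j _ => ?_
    refine (MvPolynomial.totalDegree_mul _ _).trans ?_
    refine (add_le_add le_rfl (MvPolynomial.totalDegree_mul _ _)).trans ?_
    simp
  have hdvd := char_dvd_card_solutions p hf
  have heval : ∀ x, MvPolynomial.eval x f = ∑ i, ∑ j, a i j * (x i * x j) := by
    intro x; simp [f]
  by_contra! hcon
  have hcard : Fintype.card {x : Fin 3 → k // MvPolynomial.eval x f = 0} = 1 := by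
    rw [Fintype.card_eq_one_iff]
    refine ⟨⟨0, (heval 0).trans (by simp)⟩, fun y => Subtype.ext ?_⟩
    by_contra hy
    exact hcon y.1 hy ((heval _).symm.trans y.2)
  rw [hcard] at hdvd
  exact hp'.one_lt.ne' (Nat.dvd_one.1 hdvd)

variable {A K V : Type*} [CommRing A] [Field K] [Algebra A K] [IsFractionRing A K]
  [AddCommGroup V] [Module K V] [Module A V] [IsScalarTower A K V]

/-- A lattice of rank at least `n` contains `n` vectors that are linearly independent modulo a
maximal ideal. -/
theorem exists_linearIndependent_mod {L : Submodule A V} (hfg : L.FG)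
    (hspan : Submodule.span K (L : Set V) = ⊤) (P : Ideal A) [P.IsMaximal] {n : ℕ}
    (hn : n ≤ finrank K V) :
    ∃ x : Fin n → L, ∀ c : Fin n → A,
      ∑ i, c i • x i ∈ (P • ⊤ : Submodule A L) → ∀ i, c i ∈ P := by
  let k := A ⧸ P
  let : Field k := Ideal.Quotient.field P
  let W := L ⧸ (P • ⊤ : Submodule A L)
  have hfin : Module.Finite A L := Module.Finite.iff_fg.2 hfg
  have : Module.Finite k W := Module.Finite.of_restrictScalars_finite A k W
  let b := Module.finBasis k W
  choose y hy using fun i => Submodule.mkQ_surjective (P • ⊤ : Submodule A L) (b i)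
  have hsmul : ∀ (c : A) (z : L), (Submodule.mkQ (P • ⊤ : Submodule A L)) (c • z) =
      (Ideal.Quotient.mk P c : k) • (Submodule.mkQ (P • ⊤ : Submodule A L) z : W) :=
    fun c z => rfl
  have hle : n ≤ finrank k W := by
    refine hn.trans ?_
    let N : Submodule A L := Submodule.span A (Set.range y)
    have hsup : ∀ z : L, ∃ w ∈ N, z - w ∈ (P • ⊤ : Submodule A L) := by
      intro z
      have hz := b.sum_repr (Submodule.mkQ (P • ⊤ : Submodule A L) z)
      choose c hc using fun i => Ideal.Quotient.mk_surjective (I := P)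
        (b.repr (Submodule.mkQ (P • ⊤ : Submodule A L) z) i)
      refine ⟨∑ i, c i • y i, sum_mem fun i _ => N.smul_mem _ (Submodule.subset_span ⟨i, rfl⟩), ?_⟩
      have hker := fun q => SetLike.ext_iff.1 (Submodule.ker_mkQ (P • ⊤ : Submodule A L)) q
      refine (hker _).1 ?_
      rw [LinearMap.mem_ker, map_sub, map_sum, sub_eq_zero, ← hz]
      refine Finset.sum_congr rfl fun i _ => ?_
      rw [hsmul, hy, hc]
    have htop : (⊤ : Submodule A (L ⧸ N)) ≤ P • ⊤ := by
      intro q _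
      obtain ⟨z, rfl⟩ := N.mkQ_surjective q
      obtain ⟨w, hw, hzw⟩ := hsup z
      have h1 : N.mkQ z = N.mkQ (z - w) := by
        have h0 : N.mkQ w = 0 := (Submodule.Quotient.mk_eq_zero N).2 hw
        rw [map_sub, h0, sub_zero]
      rw [h1]
      have h2 := Submodule.mem_map_of_mem (f := N.mkQ) hzw
      rw [Submodule.map_smul''] at h2
      exact Submodule.smul_mono le_rfl le_top h2
    -- Nakayama: some `r ≡ 1` modulo `P`, hence nonzero, satisfies `r L ⊆ N`. So lifts of a basis of
    -- `L / P L` span `V` over `K`, which bounds `dim V` by `dim L / P L`.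
    obtain ⟨r, hr1, hr⟩ := Submodule.exists_sub_one_mem_and_smul_eq_zero_of_fg_of_le_smul P
      (⊤ : Submodule A (L ⧸ N)) Module.Finite.fg_top htop
    have hr0 : algebraMap A K r ≠ 0 := by
      intro h0
      rw [FaithfulSMul.algebraMap_eq_zero_iff] at h0
      rw [h0, zero_sub, neg_mem_iff] at hr1
      exact (Ideal.ne_top_iff_one P).1 (Ideal.IsMaximal.ne_top inferInstance) hr1
    have hL : (L : Set V) ⊆ Submodule.span K (Set.range fun i => (y i : V)) := by
      intro z hz
      have h1 : r • (⟨z, hz⟩ : L) ∈ N := by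
        rw [← Submodule.Quotient.mk_eq_zero N, Submodule.Quotient.mk_smul]
        exact hr _ trivial
      have h2 : r • z ∈ Submodule.span K (Set.range fun i => (y i : V)) := by
        have h3 := Submodule.mem_map_of_mem (f := L.subtype) h1
        rw [Submodule.map_span, ← Set.range_comp] at h3
        exact Submodule.span_le_restrictScalars A K _ h3
      rw [← algebraMap_smul K r z] at h2
      exact (Submodule.smul_mem_iff _ hr0).1 h2
    have hspan' : Submodule.span K (Set.range fun i => (y i : V)) = ⊤ := by
      rw [eq_top_iff, ← hspan, Submodule.span_le]
      exact hL
    have h4 := finrank_range_le_card (R := K) (b := fun i => (y i : V))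
    rw [Set.finrank, hspan', finrank_top, Fintype.card_fin] at h4
    exact h4
  refine ⟨fun i => y (Fin.castLE hle i), fun c hc i => ?_⟩
  have h0 := (LinearMap.mem_ker (f := Submodule.mkQ (P • ⊤ : Submodule A L))).1
    (by rw [Submodule.ker_mkQ]; exact hc)
  rw [map_sum] at h0
  have hli := b.linearIndependent.comp _ (Fin.castLE_injective hle)
  have h5 := Fintype.linearIndependent_iff.1 hli (fun i => Ideal.Quotient.mk P (c i)) (by
    rw [← h0]
    refine Finset.sum_congr rfl fun i _ => ?_
    rw [hsmul, hy]; rfl) i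
  exact Ideal.Quotient.eq_zero_iff_mem.1 h5

end ResidualReduction

/-! ### Even unimodular lattices modulo a prime. -/

section UnimodularLattice

open Module IsDedekindDomain

variable {F : Type*} [Field F] [NumberField F]
variable {V : Type*} [AddCommGroup V] [Module F V] [Module (𝓞 F) V]

theorem differentIdeal_int_ne_bot : differentIdeal ℤ (𝓞 F) ≠ ⊥ :=
  differentIdeal_ne_bot

theorem differentIdeal_mul_inverseDifferent :
    (differentIdeal ℤ (𝓞 F) : FractionalIdeal (𝓞 F)⁰ F) * inverseDifferent F = 1 :=
  FractionalIdeal.coe_ideal_mul_inv _ differentIdeal_int_ne_bot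

theorem one_mem_inverseDifferent : (1 : F) ∈ inverseDifferent F := by
  rw [inverseDifferent, FractionalIdeal.mem_inv_iff
    (FractionalIdeal.coeIdeal_ne_zero.2 differentIdeal_int_ne_bot)]
  intro y hy
  rw [one_mul]
  exact FractionalIdeal.coeIdeal_le_one hy

/-- A local generator of the different at a prime ideal. -/
theorem exists_local_generator_different (P : Ideal (𝓞 F)) [hP : P.IsPrime] :
    ∃ d : F, (∀ a ∈ inverseDifferent F, ∃ r : 𝓞 F, algebraMap (𝓞 F) F r = d * a) ∧
      ∃ a ∈ inverseDifferent F, ∃ s : 𝓞 F, s ∉ P ∧ algebraMap (𝓞 F) F s = d * a := by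
  have hint : ∀ d ∈ (differentIdeal ℤ (𝓞 F) : FractionalIdeal (𝓞 F)⁰ F),
      ∀ a ∈ inverseDifferent F, ∃ r : 𝓞 F, algebraMap (𝓞 F) F r = d * a := by
    intro d hd a ha
    have h := FractionalIdeal.mul_mem_mul hd ha
    rw [differentIdeal_mul_inverseDifferent] at h
    exact (FractionalIdeal.mem_one_iff _).1 h
  -- Otherwise all products of elements of `𝔡` and `𝔡⁻¹` lie in `P`, contradicting `𝔡 𝔡⁻¹ = 1`.
  by_contra! hcon
  have hle : ∀ t ∈ (differentIdeal ℤ (𝓞 F) : FractionalIdeal (𝓞 F)⁰ F) * inverseDifferent F,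
      ∃ s ∈ P, algebraMap (𝓞 F) F s = t := by
    intro t ht
    refine FractionalIdeal.mul_induction_on ht (fun d hd a ha => ?_) ?_
    · obtain ⟨s, hs⟩ := hint d hd a ha
      refine ⟨s, ?_, hs⟩
      by_contra hsP
      exact hcon d (hint d hd) a ha s hsP hs
    · rintro x y ⟨s, hs, rfl⟩ ⟨s', hs', rfl⟩
      exact ⟨s + s', add_mem hs hs', map_add _ _ _⟩
  rw [differentIdeal_mul_inverseDifferent] at hle
  obtain ⟨s, hs, hs1⟩ := hle 1 (FractionalIdeal.one_mem_one _)
  rw [← map_one (algebraMap (𝓞 F) F), (FaithfulSMul.algebraMap_injective (𝓞 F) F).eq_iff] at hs1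
  exact hP.ne_top ((Ideal.eq_top_iff_one P).2 (hs1 ▸ hs))

theorem polar_mem_inverseDifferent {Q : QuadraticForm F V} {L : Submodule (𝓞 F) V}
    (huni : IsZUnimodular Q L) {x y : V} (hx : x ∈ L) (hy : y ∈ L) :
    QuadraticMap.polar Q x y ∈ inverseDifferent F := by
  have h : x ∈ latticeDual Q L := by rw [huni]; exact hx
  exact h y hy

variable [IsScalarTower (𝓞 F) F V]

/-- The reduction of a unimodular lattice modulo a prime is non-degenerate. -/
theorem mem_smul_of_forall_polar_mem {Q : QuadraticForm F V} {L : Submodule (𝓞 F) V}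
    (huni : IsZUnimodular Q L) (v : HeightOneSpectrum (𝓞 F)) {d a : F} {s : 𝓞 F}
    (ha : a ∈ inverseDifferent F) (hs : s ∉ v.asIdeal) (hda : algebraMap (𝓞 F) F s = d * a)
    {x : V} (hx : x ∈ L)
    (h : ∀ y ∈ L, ∃ r ∈ v.asIdeal, algebraMap (𝓞 F) F r = d * QuadraticMap.polar Q x y) :
    x ∈ v.asIdeal • L := by
  have : v.asIdeal.IsMaximal := v.isMaximal
  have hmul := FractionalIdeal.coe_ideal_mul_inv (K := F) v.asIdeal v.ne_bot
  set P : FractionalIdeal (𝓞 F)⁰ F := (v.asIdeal : FractionalIdeal (𝓞 F)⁰ F) with hP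
  have hmem : ∀ y ∈ L, QuadraticMap.polar Q x y ∈ P * inverseDifferent F := by
    intro y hy
    obtain ⟨r, hr, hr'⟩ := h y hy
    -- From `t s + m = 1` and `s = d a`, the value `(x, y)` equals `t r a + m (x, y)`, with `t r`
    -- and `m` in the prime.
    obtain ⟨t, m, hm, ht⟩ := Ideal.IsMaximal.exists_inv ‹_› hs
    have h1 : QuadraticMap.polar Q x y = algebraMap (𝓞 F) F (t * r) * a +
        algebraMap (𝓞 F) F m * QuadraticMap.polar Q x y := by
      have h2 := congrArg (algebraMap (𝓞 F) F) ht
      rw [map_add, map_mul, map_one, hda] at h2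
      rw [map_mul, hr']
      linear_combination (-QuadraticMap.polar Q x y) * h2
    rw [h1]
    have h2 := FractionalIdeal.mul_mem_mul (I := P) (FractionalIdeal.mem_coeIdeal_of_mem (𝓞 F)⁰
      (Ideal.mul_mem_left _ t hr)) ha
    have h3 := FractionalIdeal.mul_mem_mul (I := P) (FractionalIdeal.mem_coeIdeal_of_mem (𝓞 F)⁰ hm)
      (polar_mem_inverseDifferent huni hx hy)
    exact (P * inverseDifferent F).val.add_mem h2 h3
  -- Since `(x, L) ⊆ P 𝔡⁻¹`, the multiples `P⁻¹ x` lie in the dual `L' = L`; then `x ∈ P P⁻¹ x ⊆ P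
  -- L`.
  have hL : ∀ z ∈ P⁻¹, z • x ∈ L := by
    intro z hz
    have h1 : z • x ∈ latticeDual Q L := by
      intro y hy
      rw [QuadraticMap.polar_smul_left, smul_eq_mul]
      have h2 := FractionalIdeal.mul_mem_mul hz (hmem y hy)
      rwa [← mul_assoc, mul_comm P⁻¹, hmul, one_mul] at h2
    rw [huni] at h1
    exact h1
  have key : ∀ t ∈ P * P⁻¹, t • x ∈ v.asIdeal • L := by
    intro t ht
    refine FractionalIdeal.mul_induction_on ht (fun i hi z hz => ?_) fun t t' ht ht' => ?_
    · obtain ⟨r, hr, rfl⟩ := (FractionalIdeal.mem_coeIdeal _).1 hi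
      rw [mul_smul, algebraMap_smul]
      exact Submodule.smul_mem_smul hr (hL z hz)
    · rw [add_smul]; exact add_mem ht ht'
  have h1 := key 1 (by rw [hmul]; exact FractionalIdeal.one_mem_one _)
  rwa [one_smul] at h1

theorem sum_upperTriangular_three {A : Type*} [CommRing A] (q₀ q₁ q₂ p₀ p₁ p₂ : A)
    (c : Fin 3 → A) :
    ∑ i, ∑ j, (![![q₀, p₀, p₁], ![0, q₁, p₂], ![0, 0, q₂]] : Fin 3 → Fin 3 → A) i j *
      (c i * c j) = q₀ * (c 0 * c 0) + q₁ * (c 1 * c 1) + q₂ * (c 2 * c 2) + p₀ * (c 0 * c 1) +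
        p₁ * (c 0 * c 2) + p₂ * (c 1 * c 2) := by
  simp [Fin.sum_univ_three]
  ring

/-- An even unimodular lattice of rank at least three contains, up to a local generator `d` of the
different, a vector `x` which is isotropic modulo a given prime and not in the radical modulo this
prime. -/
theorem exists_isotropic_mod {Q : QuadraticForm F V} {L : Submodule (𝓞 F) V}
    (hL : L.IsLattice F) (heven : IsEvenLattice Q L) (huni : IsZUnimodular Q L)
    (hrank : 3 ≤ finrank F V) (v : HeightOneSpectrum (𝓞 F)) :
    ∃ d : F, (∀ a ∈ inverseDifferent F, ∃ r : 𝓞 F, algebraMap (𝓞 F) F r = d * a) ∧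
      ∃ x ∈ L, ∃ y ∈ L, (∃ r ∈ v.asIdeal, algebraMap (𝓞 F) F r = d * Q x) ∧
        ∃ r, r ∉ v.asIdeal ∧ algebraMap (𝓞 F) F r = d * QuadraticMap.polar Q x y := by
  classical
  have : v.asIdeal.IsMaximal := v.isMaximal
  have : Finite (𝓞 F ⧸ v.asIdeal) := v.asIdeal.finiteQuotientOfFreeOfNeBot v.ne_bot
  let : Field (𝓞 F ⧸ v.asIdeal) := Ideal.Quotient.field _
  obtain ⟨d, hd, a, ha, s, hs, hda⟩ := exists_local_generator_different v.asIdeal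
  obtain ⟨x, hx⟩ := exists_linearIndependent_mod (K := F) hL.fg hL.span_eq_top v.asIdeal hrank
  choose q hq using fun i => hd _ (heven _ (x i).2)
  choose p hp using fun i j => hd _ (polar_mem_inverseDifferent huni (x i).2 (x j).2)
  -- The upper triangular matrix represents `d Q` itself, not its polar form, so residue
  -- characteristic two needs no separate treatment.
  let m : Fin 3 → Fin 3 → 𝓞 F := ![![q 0, p 0 1, p 0 2], ![0, q 1, p 1 2], ![0, 0, q 2]]
  obtain ⟨c', hc0, hc'⟩ := exists_ternary_zero fun i j => Ideal.Quotient.mk v.asIdeal (m i j)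
  choose c hc using fun i => Ideal.Quotient.mk_surjective (I := v.asIdeal) (c' i)
  let z : L := ∑ i, c i • x i
  have hzv : (z : V) = ∑ i, algebraMap (𝓞 F) F (c i) • (x i : V) := by
    simp [z]
  have hQz : algebraMap (𝓞 F) F (∑ i, ∑ j, m i j * (c i * c j)) = d * Q z := by
    have hm : ∑ i, ∑ j, m i j * (c i * c j) = q 0 * (c 0 * c 0) + q 1 * (c 1 * c 1) +
        q 2 * (c 2 * c 2) + p 0 1 * (c 0 * c 1) + p 0 2 * (c 0 * c 2) + p 1 2 * (c 1 * c 2) := by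
      exact sum_upperTriangular_three _ _ _ _ _ _ c
    rw [hzv, hm, Fin.sum_univ_three, QuadraticMap.map_add Q, QuadraticMap.map_add Q]
    simp only [map_add, map_mul, hq, hp, QuadraticMap.polar_add_left,
      QuadraticMap.polar_smul_left, QuadraticMap.polar_smul_right,
      QuadraticMap.map_smul, smul_eq_mul]
    ring
  have hzP : ∑ i, ∑ j, m i j * (c i * c j) ∈ v.asIdeal := by
    rw [← Ideal.Quotient.eq_zero_iff_mem, ← hc']
    simp [hc]
  have hznot : (z : V) ∉ v.asIdeal • L := by
    intro hz
    have hz' : z ∈ (v.asIdeal • ⊤ : Submodule (𝓞 F) L) := by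
      have hmap : v.asIdeal • L = (v.asIdeal • ⊤ : Submodule (𝓞 F) L).map L.subtype := by
        rw [Submodule.map_smul'', Submodule.map_top, Submodule.range_subtype]
      rw [hmap] at hz
      obtain ⟨w, hw, hwz⟩ := hz
      rwa [Subtype.ext hwz] at hw
    exact hc0 (funext fun i => by
      rw [← hc i]; exact Ideal.Quotient.eq_zero_iff_mem.2 (hx c hz' i))
  refine ⟨d, hd, z, z.2, ?_⟩
  by_contra! hcon
  refine hznot (mem_smul_of_forall_polar_mem huni v ha hs hda z.2 fun y hy => ?_)
  obtain ⟨r, hr⟩ := hd _ (polar_mem_inverseDifferent huni z.2 hy)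
  refine ⟨r, ?_, hr⟩
  by_contra hrP
  exact hcon y hy ⟨_, hzP, hQz⟩ r hrP hr

end UnimodularLattice

/-! ### Lifting an isotropic vector to a hyperbolic pair. -/

section Hensel

open IsLocalRing

/-- Modulo the maximal ideal `1` is a root, and the derivative `2 z - 1` is `1` there, so the root
is simple in every residue characteristic. -/
theorem exists_isUnit_sq_sub_add_eq_zero {A : Type*} [CommRing A] [IsLocalRing A]
    [HenselianRing A (maximalIdeal A)] {c : A} (hc : c ∈ maximalIdeal A) :
    ∃ z : Aˣ, (z : A) ^ 2 - z + c = 0 := by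
  have hmonic : (Polynomial.X ^ 2 - Polynomial.X + Polynomial.C c).Monic := by monicity!
  obtain ⟨z, hz, hz1⟩ := HenselianRing.is_henselian (I := maximalIdeal A)
    (Polynomial.X ^ 2 - Polynomial.X + Polynomial.C c) hmonic 1 (by simpa using hc) (by
      norm_num [Polynomial.derivative_X_pow])
  have hu : IsUnit z := by
    by_contra h
    have h1 := sub_mem ((mem_maximalIdeal z).2 h) hz1
    rw [sub_sub_cancel] at h1
    exact (Ideal.ne_top_iff_one _).1 (maximalIdeal.isMaximal A).ne_top h1
  obtain ⟨z, rfl⟩ := hu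
  exact ⟨z, by simpa [Polynomial.IsRoot] using hz⟩

/-- Hensel's lemma for quadratic forms: a pair of vectors whose Gram matrix becomes invertible and
isotropic in the first vector modulo the maximal ideal can be deformed to a hyperbolic pair. -/
theorem exists_hyperbolic_of_isotropic_mod {A K W : Type*} [CommRing A] [IsLocalRing A]
    [HenselianRing A (maximalIdeal A)] [Field K] [Algebra A K] [AddCommGroup W] [Module K W] (b : LinearMap.BilinForm K W) (hb : b.IsSymm)
    {d : K} {x y : W} {qx qy : A} {p : Aˣ} (hqx : qx ∈ maximalIdeal A)
    (hx : d * b x x = 2 * algebraMap A K qx) (hy : d * b y y = 2 * algebraMap A K qy)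
    (hxy : d * b x y = algebraMap A K p) :
    ∃ (t s : A) (u : Aˣ), ∀ e f : W, e = x + algebraMap A K t • y → f = y - algebraMap A K s • e →
      b e e = 0 ∧ b f f = 0 ∧ d * b e f = algebraMap A K u := by
  have hd : d ≠ 0 := by
    rintro rfl
    rw [zero_mul] at hxy
    exact (p.isUnit.map (algebraMap A K)).ne_zero hxy.symm
  obtain ⟨z, hz⟩ := exists_isUnit_sq_sub_add_eq_zero
    (Ideal.mul_mem_left _ (qy * ((p⁻¹ : Aˣ) : A) ^ 2) hqx)
  -- This substitution turns `qx + t p + t² qy = 0`, the isotropy of `x + t y`, into `z² - z + qx qy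
  -- / p² = 0`, with `z` a unit.
  let t : A := -(qx * ((p⁻¹ : Aˣ) : A) * ((z⁻¹ : Aˣ) : A))
  have hp : (p : A) * ((p⁻¹ : Aˣ) : A) = 1 := p.mul_inv
  have hzz : (z : A) * ((z⁻¹ : Aˣ) : A) = 1 := z.mul_inv
  have ht : qx + t * p + t ^ 2 * qy = 0 := by
    have h1 : (qx + t * p + t ^ 2 * qy) * z ^ 2 = 0 := by
      simp only [t]
      linear_combination qx * hz + (-qx * z ^ 2 * ((z⁻¹ : Aˣ) : A)) * hp +
        (-qx * z + qx ^ 2 * ((p⁻¹ : Aˣ) : A) ^ 2 * qy * (z * ((z⁻¹ : Aˣ) : A) + 1)) * hzz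
    exact (z.isUnit.pow 2).mul_left_eq_zero.1 h1
  have htm : t ∈ maximalIdeal A :=
    neg_mem (Ideal.mul_mem_right _ _ (Ideal.mul_mem_right _ _ hqx))
  have hU : IsUnit ((p : A) + 2 * t * qy) := by
    by_contra h
    have h1 := sub_mem ((mem_maximalIdeal _).2 h)
      (Ideal.mul_mem_right qy _ (Ideal.mul_mem_left _ 2 htm))
    rw [add_sub_cancel_right] at h1
    exact (mem_maximalIdeal _).1 h1 p.isUnit
  obtain ⟨u, hu⟩ := hU
  -- For isotropic `e` and `f = y - s e`, isotropy of `f` means `qy = s u`, where `u = d (e, y)`.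
  refine ⟨t, qy * ((u⁻¹ : Aˣ) : A), u, ?_⟩
  rintro e f rfl rfl
  have hyx : b y x = b x y := hb.eq y x
  have ht' := congrArg (algebraMap A K) ht
  have hu' := congrArg (algebraMap A K) hu
  have huu := congrArg (algebraMap A K) u.mul_inv
  simp only [map_add, map_mul, map_pow, map_zero, map_one, map_ofNat] at ht' hu' huu
  set T := algebraMap A K t
  set s := algebraMap A K (qy * ((u⁻¹ : Aˣ) : A)) with hs
  rw [map_mul] at hs
  have hee : b (x + T • y) (x + T • y) = 0 := by
    have h1 : d * b (x + T • y) (x + T • y) = 0 := by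
      simp only [map_add, LinearMap.add_apply, map_smul, LinearMap.smul_apply, smul_eq_mul, hyx]
      linear_combination hx + T ^ 2 * hy + 2 * T * hxy + 2 * ht'
    exact (mul_eq_zero.1 h1).resolve_left hd
  have hey : d * b (x + T • y) y = algebraMap A K u := by
    simp only [map_add, LinearMap.add_apply, map_smul, LinearMap.smul_apply, smul_eq_mul]
    linear_combination hxy + T * hy - hu'
  obtain ⟨e, he⟩ : ∃ e, e = x + T • y := ⟨_, rfl⟩
  rw [← he] at hee hey ⊢
  have hye : b y e = b e y := hb.eq _ _
  refine ⟨hee, ?_, ?_⟩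
  · have h1 : d * b (y - s • e) (y - s • e) = 0 := by
      simp only [map_sub, LinearMap.sub_apply, map_smul, LinearMap.smul_apply, smul_eq_mul, hee,
        hye, hs]
      linear_combination hy - 2 * algebraMap A K qy * algebraMap A K ((u⁻¹ : Aˣ) : A) * hey -
        2 * algebraMap A K qy * huu
    exact (mul_eq_zero.1 h1).resolve_left hd
  · rw [map_sub, map_smul, hee, smul_zero, sub_zero, hey]

end Hensel

/-! ### Polar forms in coordinates, to compare adelic and local forms on a generating family. -/

section GramForm

variable {F : Type*} [Field F] {V : Type*} [AddCommGroup V] [Module F V]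

/-- The polar form of `Q` in coordinates with respect to a finite family of vectors, with
coefficients in an extension of the base field. -/
noncomputable def gramForm (Q : QuadraticForm F V) {n : ℕ} (X : Fin n → V) (K : Type*) [CommRing K]
    [Algebra F K] : LinearMap.BilinForm K (Fin n → K) :=
  Matrix.toBilin' (Matrix.of fun i j => algebraMap F K (QuadraticMap.polar Q (X i) (X j)))

theorem gramForm_apply (Q : QuadraticForm F V) {n : ℕ} (X : Fin n → V) {K : Type*} [CommRing K]
    [Algebra F K] (c c' : Fin n → K) : gramForm Q X K c c' =
      ∑ i, ∑ j, c i * algebraMap F K (QuadraticMap.polar Q (X i) (X j)) * c' j := by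
  rw [gramForm, Matrix.toBilin'_apply]
  rfl

theorem gramForm_isSymm (Q : QuadraticForm F V) {n : ℕ} (X : Fin n → V) {K : Type*} [CommRing K]
    [Algebra F K] : (gramForm Q X K).IsSymm := by
  refine ⟨fun c c' => ?_⟩
  rw [gramForm_apply, gramForm_apply, Finset.sum_comm]
  refine Finset.sum_congr rfl fun i _ => Finset.sum_congr rfl fun j _ => ?_
  rw [QuadraticMap.polar_comm]
  ring

theorem gramForm_algebraMap (Q : QuadraticForm F V) {n : ℕ} (X : Fin n → V) {K : Type*}
    [CommRing K] [Algebra F K] (α β : Fin n → F) :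
    gramForm Q X K (fun i => algebraMap F K (α i)) (fun i => algebraMap F K (β i)) =
      algebraMap F K (QuadraticMap.polar Q (∑ i, α i • X i) (∑ i, β i • X i)) := by
  have h : QuadraticMap.polar Q (∑ i, α i • X i) (∑ i, β i • X i) =
      QuadraticMap.polarBilin Q (∑ i, α i • X i) (∑ i, β i • X i) := rfl
  rw [gramForm_apply, h]
  simp only [map_sum, LinearMap.sum_apply, map_smul, LinearMap.smul_apply, smul_eq_mul, map_mul,
    QuadraticMap.polarBilin_apply_apply, Finset.mul_sum]
  rw [Finset.sum_comm]
  refine Finset.sum_congr rfl fun i _ => Finset.sum_congr rfl fun j _ => ?_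
  ring

end GramForm

/-! ### Hyperbolic pairs over the completions. -/

section LocalHyperbolicPair

open IsDedekindDomain HeightOneSpectrum Module IsLocalRing

variable {F : Type*} [Field F] [NumberField F] (v : HeightOneSpectrum (𝓞 F))

open scoped Pointwise in
-- A limit of a Cauchy sequence `f` lies in all the cosets `f n + I ^ n`, which are nested, closed
-- and nonempty in a compact space. Completeness makes Hensel's lemma applicable.
theorem isAdicComplete_adicCompletionIntegers :
    IsAdicComplete (maximalIdeal (v.adicCompletionIntegers F)) (v.adicCompletionIntegers F) := by
  have := compactSpace_adicCompletionIntegers v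
  let I := maximalIdeal (v.adicCompletionIntegers F)
  refine { prec' := fun f hf => ?_ }
  let S n : Set (v.adicCompletionIntegers F) :=
    f n +ᵥ ((I ^ n : Ideal (v.adicCompletionIntegers F)) : Set (v.adicCompletionIntegers F))
  have hS n : S (n + 1) ⊆ S n := by
    apply (Set.vadd_set_subset_vadd_set_iff.mpr (Ideal.pow_le_pow_right n.le_succ)).trans
    simpa [S] using (hf n.le_succ).symm
  have h n : IsClosed (S n) := (IsNoetherianRing.isClosed_ideal (I ^ n)).vadd (f n)
  obtain ⟨l, hl⟩ := (h 0).isCompact.nonempty_iInter_of_sequence_nonempty_isCompact_isClosed S hS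
    (by simp [S]) h
  refine ⟨l, fun n => ?_⟩
  obtain ⟨y, hy, rfl⟩ := Set.mem_iInter.mp hl n
  simpa [SModEq.sub_mem] using hy

variable {V : Type*} [AddCommGroup V] [Module F V] [Module (𝓞 F) V] [IsScalarTower (𝓞 F) F V]

/-- Coordinates refer to a generating family `X` of `L`, which need not be a basis since `L` need
not be free; the same family serves all places, which allows gluing. -/
theorem exists_local_hyperbolicPair {Q : QuadraticForm F V} {L : Submodule (𝓞 F) V}
    (hL : L.IsLattice F) (heven : IsEvenLattice Q L) (huni : IsZUnimodular Q L)
    (hrank : 3 ≤ finrank F V) {n : ℕ} {X : Fin n → V}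
    (hX : Submodule.span (𝓞 F) (Set.range X) = L) :
    ∃ (c c' : Fin n → v.adicCompletion F) (d : v.adicCompletion F),
      (∀ i, c i ∈ v.adicCompletionIntegers F) ∧ (∀ i, c' i ∈ v.adicCompletionIntegers F) ∧
      gramForm Q X (v.adicCompletion F) c c = 0 ∧ gramForm Q X (v.adicCompletion F) c' c' = 0 ∧
      d * gramForm Q X (v.adicCompletion F) c c' = 1 ∧
      ∀ a ∈ inverseDifferent F, d * algebraMap F _ a ∈ v.adicCompletionIntegers F := by
  have := isAdicComplete_adicCompletionIntegers v
  obtain ⟨d, hd, x, hx, y, hy, ⟨qx, hqx, hqx'⟩, p, hp, hp'⟩ :=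
    exists_isotropic_mod hL heven huni hrank v
  obtain ⟨qy, hqy⟩ := hd _ (heven y hy)
  have hcoord : ∀ z ∈ L, ∃ α : Fin n → 𝓞 F, ∑ i, algebraMap (𝓞 F) F (α i) • X i = z := by
    intro z hz
    rw [← hX, ← Fintype.range_linearCombination (𝓞 F)] at hz
    obtain ⟨α, rfl⟩ := hz
    exact ⟨α, by simp [Fintype.linearCombination_apply]⟩
  obtain ⟨α, hα⟩ := hcoord x hx
  obtain ⟨β, hβ⟩ := hcoord y hy
  let j : 𝓞 F →+* v.adicCompletionIntegers F := algebraMap (𝓞 F) (v.adicCompletionIntegers F)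
  have hj : ∀ r, algebraMap (v.adicCompletionIntegers F) (v.adicCompletion F) (j r) =
      algebraMap F (v.adicCompletion F) (algebraMap (𝓞 F) F r) := fun r => rfl
  have hjv : ∀ r, Valued.v (algebraMap (v.adicCompletionIntegers F) (v.adicCompletion F) (j r)) =
      v.valuation F (algebraMap (𝓞 F) F r) := fun r => valuedAdicCompletion_eq_valuation v r
  have hunit : ∀ r, IsUnit (j r) ↔ r ∉ v.asIdeal := by
    intro r
    rw [adicCompletionIntegers.isUnit_iff_valued_eq_one, ← v.valuation_eq_one_iff_notMem (K := F),
      ← hjv]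
    rfl
  obtain ⟨p', hp''⟩ := (hunit p).2 hp
  have hpolar : ∀ z, algebraMap F (v.adicCompletion F) d *
      algebraMap F (v.adicCompletion F) (QuadraticMap.polar Q z z) =
        2 * algebraMap F (v.adicCompletion F) (d * Q z) := fun z => by
    rw [QuadraticMap.polar_self, two_smul, map_add, map_mul]
    ring
  let x' : Fin n → v.adicCompletion F := fun i => algebraMap F _ (algebraMap (𝓞 F) F (α i))
  let y' : Fin n → v.adicCompletion F := fun i => algebraMap F _ (algebraMap (𝓞 F) F (β i))
  obtain ⟨t, s, u, h⟩ := exists_hyperbolic_of_isotropic_mod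
    (A := v.adicCompletionIntegers F) (gramForm Q X (v.adicCompletion F)) (gramForm_isSymm Q X)
    (d := algebraMap F _ d) (x := x') (y := y') (qx := j qx) (qy := j qy) (p := p')
    ((mem_maximalIdeal _).2 fun h => (hunit qx).1 h hqx)
    (by rw [gramForm_algebraMap, hα, hpolar, hj, hqx'])
    (by rw [gramForm_algebraMap, hβ, hpolar, hj, hqy])
    (by rw [gramForm_algebraMap, hα, hβ, hp'', hj, hp', ← map_mul])
  obtain ⟨e, he⟩ : ∃ e : Fin n → v.adicCompletion F,
      e = x' + algebraMap (v.adicCompletionIntegers F) (v.adicCompletion F) t • y' := ⟨_, rfl⟩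
  obtain ⟨f, hf⟩ : ∃ f : Fin n → v.adicCompletion F,
      f = y' - algebraMap (v.adicCompletionIntegers F) (v.adicCompletion F) s • e := ⟨_, rfl⟩
  obtain ⟨hee, hff, hef⟩ := h e f he hf
  have hemem : ∀ i, e i ∈ v.adicCompletionIntegers F := fun i => by
    rw [he]
    exact add_mem (j (α i)).2 (mul_mem t.2 (j (β i)).2)
  have hfmem : ∀ i, f i ∈ v.adicCompletionIntegers F := fun i => by
    rw [hf]
    exact sub_mem (j (β i)).2 (mul_mem s.2 (hemem i))
  -- Rescaling `d` by the integral unit `u⁻¹` normalizes `d (e, f)` to `1` and keeps `d 𝔡⁻¹`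
  -- integral.
  refine ⟨e, f, algebraMap (v.adicCompletionIntegers F) (v.adicCompletion F) ((u⁻¹ : Units _) : _) *
    algebraMap F _ d, hemem, hfmem, hee, hff, ?_, ?_⟩
  · rw [mul_assoc, hef, ← map_mul, Units.inv_mul, map_one]
  · intro a ha
    obtain ⟨r, hr⟩ := hd a ha
    rw [mul_assoc, ← map_mul, ← hr]
    exact mul_mem (Subtype.prop _) (j r).2

end LocalHyperbolicPair

/-! ### The adelic lattice and its hyperbolic pair. -/

section AdelicLattice

open IsDedekindDomain HeightOneSpectrum Module

variable {F : Type*} [Field F] [NumberField F] {V : Type*} [AddCommGroup V] [Module F V]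

theorem isUnit_two_finAdeles : IsUnit (2 : FinAdeles F) := by
  have h := (IsUnit.mk0 (2 : F) two_ne_zero).map (algebraMap F (FinAdeles F))
  rwa [map_ofNat] at h

theorem polar_adelicForm_tmul (Q : QuadraticForm F V) (a b : FinAdeles F) (x y : V) :
    QuadraticMap.polar (adelicForm Q) (a ⊗ₜ x) (b ⊗ₜ y) =
      a * b * algebraMap F (FinAdeles F) (QuadraticMap.polar Q x y) := by
  let : Invertible (2 : F) := invertibleOfNonzero two_ne_zero
  let : Invertible (2 : FinAdeles F) := isUnit_two_finAdeles.invertible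
  have h : QuadraticMap.polarBilin (adelicForm Q) =
      LinearMap.BilinForm.baseChange (FinAdeles F) (QuadraticMap.polarBilin Q) :=
    QuadraticForm.polarBilin_baseChange Q
  rw [← QuadraticMap.polarBilin_apply_apply, h, LinearMap.BilinForm.baseChange_tmul,
    Algebra.smul_def, mul_comm]
  rfl

theorem adelicForm_one_tmul (Q : QuadraticForm F V) (x : V) :
    adelicForm Q (1 ⊗ₜ x) = algebraMap F (FinAdeles F) (Q x) := by
  let : Invertible (2 : F) := invertibleOfNonzero two_ne_zero
  have h : adelicForm Q (1 ⊗ₜ x) = Q x • ((1 : FinAdeles F) * 1) :=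
    QuadraticForm.baseChange_tmul Q 1 x
  rw [h, Algebra.smul_def, one_mul, mul_one]

theorem polar_adelicForm_sum (Q : QuadraticForm F V) {n : ℕ} (X : Fin n → V)
    (c c' : Fin n → FinAdeles F) :
    QuadraticMap.polar (adelicForm Q) (∑ i, c i ⊗ₜ X i) (∑ i, c' i ⊗ₜ X i) =
      gramForm Q X (FinAdeles F) c c' := by
  rw [← QuadraticMap.polarBilin_apply_apply, gramForm_apply]
  simp only [map_sum, LinearMap.sum_apply, QuadraticMap.polarBilin_apply_apply,
    polar_adelicForm_tmul]
  rw [Finset.sum_comm]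
  refine Finset.sum_congr rfl fun i _ => Finset.sum_congr rfl fun j _ => ?_
  ring

/-- The component of a finite adele at a finite place. -/
def finAdeleEval (v : HeightOneSpectrum (𝓞 F)) : FinAdeles F →+* v.adicCompletion F where
  toFun a := a v
  map_one' := rfl
  map_mul' _ _ := rfl
  map_zero' := rfl
  map_add' _ _ := rfl

theorem gramForm_finAdeles_apply (Q : QuadraticForm F V) {n : ℕ} (X : Fin n → V)
    (c c' : Fin n → FinAdeles F) (v : HeightOneSpectrum (𝓞 F)) :
    gramForm Q X (FinAdeles F) c c' v =
      gramForm Q X (v.adicCompletion F) (fun i => c i v) (fun i => c' i v) := by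
  change finAdeleEval v _ = _
  rw [gramForm_apply, gramForm_apply]
  simp only [map_sum, map_mul]
  rfl

/-- The integral adele with prescribed components. -/
def integralAdeleMk (a : ∀ v : HeightOneSpectrum (𝓞 F), v.adicCompletion F)
    (ha : ∀ v, a v ∈ v.adicCompletionIntegers F) : FinAdeles F :=
  ⟨a, Filter.Eventually.of_forall ha⟩

theorem integralAdeleMk_mem {a : ∀ v : HeightOneSpectrum (𝓞 F), v.adicCompletion F}
    (ha : ∀ v, a v ∈ v.adicCompletionIntegers F) : integralAdeleMk a ha ∈ integralAdeles F :=
  ha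

theorem algebraMap_mem_integralAdeles (r : 𝓞 F) :
    algebraMap F (FinAdeles F) (algebraMap (𝓞 F) F r) ∈ integralAdeles F :=
  fun v => v.coe_algebraMap_mem (𝓞 F) F r

theorem integralAdeles_smul (r : integralAdeles F) (z : FinAdeles F ⊗[F] V) :
    r • z = (r : FinAdeles F) • z :=
  (algebraMap_smul (FinAdeles F) r z).symm

theorem exists_basis_adelicForm_orthogonal [Module.Finite F V] (Q : QuadraticForm F V)
    (hQ : (QuadraticMap.polarBilin Q).Nondegenerate) :
    ∃ b : Basis (Fin (finrank F V)) (FinAdeles F) (FinAdeles F ⊗[F] V),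
      (∀ i, IsUnit (adelicForm Q (b i))) ∧
        ∀ i j, i ≠ j → QuadraticMap.polar (adelicForm Q) (b i) (b j) = 0 := by
  let : Invertible (2 : F) := invertibleOfNonzero two_ne_zero
  obtain ⟨b, hb⟩ := LinearMap.BilinForm.exists_orthogonal_basis
    (B := QuadraticMap.polarBilin Q) ⟨fun x y => QuadraticMap.polar_comm Q x y⟩
  refine ⟨b.baseChange (FinAdeles F), fun i => ?_, fun i j hij => ?_⟩
  · rw [Basis.baseChange_apply, adelicForm_one_tmul]
    refine IsUnit.map _ (IsUnit.mk0 _ fun h => ?_)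
    have h1 := hb.not_isOrtho_basis_self_of_separatingLeft hQ.1 i
    refine h1 ?_
    change QuadraticMap.polar Q (b i) (b i) = 0
    rw [QuadraticMap.polar_self, h, smul_zero]
  · rw [Basis.baseChange_apply, Basis.baseChange_apply, polar_adelicForm_tmul]
    have h : QuadraticMap.polar Q (b i) (b j) = 0 := hb hij
    rw [h, map_zero, mul_zero]

variable [Module (𝓞 F) V]

theorem tmul_mem_latticeHat {L : Submodule (𝓞 F) V} {a : FinAdeles F} (ha : a ∈ integralAdeles F)
    {x : V} (hx : x ∈ L) : a ⊗ₜ x ∈ latticeHat L := by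
  have h := (latticeHat L).smul_mem ⟨a, ha⟩ (Submodule.subset_span ⟨x, hx, rfl⟩)
  have h1 : (⟨a, ha⟩ : integralAdeles F) • ((1 : FinAdeles F) ⊗ₜ[F] x) = a ⊗ₜ x := by
    rw [integralAdeles_smul, TensorProduct.smul_tmul', smul_eq_mul, mul_one]
  rwa [← h1]

theorem exists_basis_mem_latticeHat {L : Submodule (𝓞 F) V}
    (hspan : Submodule.span F (L : Set V) = ⊤) [Module.Finite F V] :
    ∃ b : Basis (Fin (finrank F V)) (FinAdeles F) (FinAdeles F ⊗[F] V), ∀ i, b i ∈ latticeHat L := by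
  obtain ⟨s, hsL, hs, hli⟩ := exists_linearIndependent F (L : Set V)
  let b : Basis s F V := Basis.mk hli (by rw [Subtype.range_coe, hs, hspan])
  have : Finite s := Module.Finite.finite_basis b
  have := Fintype.ofFinite s
  let b' := b.reindex (Fintype.equivFinOfCardEq (finrank_eq_card_basis b).symm)
  refine ⟨b'.baseChange (FinAdeles F), fun i => ?_⟩
  rw [Basis.baseChange_apply]
  refine tmul_mem_latticeHat (one_mem _) ?_
  rw [Basis.reindex_apply, Basis.mk_apply]
  exact hsL (Subtype.prop _)

theorem mul_polar_mem_integralAdeles {Q : QuadraticForm F V} {L : Submodule (𝓞 F) V}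
    (huni : IsZUnimodular Q L) {d : FinAdeles F}
    (hd : ∀ a ∈ inverseDifferent F, d * algebraMap F (FinAdeles F) a ∈ integralAdeles F)
    {x y : FinAdeles F ⊗[F] V} (hx : x ∈ latticeHat L) (hy : y ∈ latticeHat L) :
    d * QuadraticMap.polar (adelicForm Q) x y ∈ integralAdeles F := by
  induction hx using Submodule.span_induction with
  | mem x hx =>
    obtain ⟨x, hx, rfl⟩ := hx
    induction hy using Submodule.span_induction with
    | mem y hy =>
      obtain ⟨y, hy, rfl⟩ := hy
      simp only [polar_adelicForm_tmul, one_mul]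
      exact hd _ (polar_mem_inverseDifferent huni hx hy)
    | zero => rw [QuadraticMap.polar_zero_right, mul_zero]; exact zero_mem _
    | add _ _ _ _ h1 h2 => rw [QuadraticMap.polar_add_right, mul_add]; exact add_mem h1 h2
    | smul r _ _ h =>
      rw [integralAdeles_smul, QuadraticMap.polar_smul_right, smul_eq_mul, mul_left_comm]
      exact mul_mem r.2 h
  | zero => rw [QuadraticMap.polar_zero_left, mul_zero]; exact zero_mem _
  | add _ _ _ _ h1 h2 => rw [QuadraticMap.polar_add_left, mul_add]; exact add_mem h1 h2
  | smul r _ _ h =>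
    rw [integralAdeles_smul, QuadraticMap.polar_smul_left, smul_eq_mul, mul_left_comm]
    exact mul_mem r.2 h

variable [IsScalarTower (𝓞 F) F V]

theorem fg_latticeHat {L : Submodule (𝓞 F) V} {n : ℕ} {X : Fin n → V}
    (hX : Submodule.span (𝓞 F) (Set.range X) = L) : (latticeHat L).FG := by
  have h : latticeHat L = Submodule.span (integralAdeles F)
      (Set.range fun i => (1 : FinAdeles F) ⊗ₜ[F] X i) := by
    refine le_antisymm (Submodule.span_le.2 ?_) (Submodule.span_le.2 ?_)
    · rintro _ ⟨x, hx, rfl⟩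
      rw [← hX] at hx
      induction hx using Submodule.span_induction with
      | mem y hy =>
        obtain ⟨i, rfl⟩ := hy
        exact Submodule.subset_span ⟨i, rfl⟩
      | zero => simp
      | add y z _ _ h1 h2 =>
        simp only [TensorProduct.tmul_add]
        exact add_mem h1 h2
      | smul r y _ h1 =>
        have h2 := Submodule.smul_mem _ ⟨_, algebraMap_mem_integralAdeles r⟩ h1
        have h3 : (1 : FinAdeles F) ⊗ₜ[F] (r • y) =
            (⟨_, algebraMap_mem_integralAdeles r⟩ : integralAdeles F) •
              ((1 : FinAdeles F) ⊗ₜ[F] y) := by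
          rw [integralAdeles_smul, TensorProduct.smul_tmul', ← algebraMap_smul F r y,
            ← TensorProduct.smul_tmul, smul_eq_mul, mul_one, Algebra.smul_def, mul_one]
        change (1 : FinAdeles F) ⊗ₜ[F] (r • y) ∈ Submodule.span _ _
        rw [h3]
        exact h2
    · rintro _ ⟨i, rfl⟩
      refine Submodule.subset_span ⟨X i, ?_, rfl⟩
      rw [← hX]
      exact Submodule.subset_span ⟨i, rfl⟩
  rw [h]
  exact Submodule.fg_span (Set.finite_range _)

open GeneralSpin in
/-- The adelic completion of an even unimodular lattice of rank at least three contains a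
hyperbolic pair. -/
theorem exists_isHyperbolicPair_adelicForm {Q : QuadraticForm F V} {L : Submodule (𝓞 F) V}
    (hL : L.IsLattice F) (heven : IsEvenLattice Q L) (huni : IsZUnimodular Q L)
    (hrank : 3 ≤ finrank F V) {n : ℕ} {X : Fin n → V}
    (hX : Submodule.span (𝓞 F) (Set.range X) = L) :
    ∃ (d : FinAdeles F) (e f : FinAdeles F ⊗[F] V), IsHyperbolicPair (adelicForm Q) d e f ∧
      e ∈ latticeHat L ∧ f ∈ latticeHat L ∧
      ∀ a ∈ inverseDifferent F, d * algebraMap F (FinAdeles F) a ∈ integralAdeles F := by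
  choose c c' d hc hc' hcc hcc' hd hda using
    fun v => exists_local_hyperbolicPair v hL heven huni hrank hX
  -- As `1 ∈ 𝔡⁻¹`, each local `d` is integral, so together they form a finite adele.
  have hdint : ∀ v, d v ∈ v.adicCompletionIntegers F := fun v => by
    have h := hda v 1 one_mem_inverseDifferent
    rwa [map_one, mul_one] at h
  let C : Fin n → FinAdeles F := fun i => integralAdeleMk (fun v => c v i) fun v => hc v i
  let C' : Fin n → FinAdeles F := fun i => integralAdeleMk (fun v => c' v i) fun v => hc' v i
  have hXL : ∀ i, X i ∈ L := fun i => hX ▸ Submodule.subset_span ⟨i, rfl⟩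
  have hiso : ∀ z : FinAdeles F ⊗[F] V, QuadraticMap.polar (adelicForm Q) z z = 0 →
      adelicForm Q z = 0 := by
    intro z hz
    rw [QuadraticMap.polar_self, two_smul, ← two_mul] at hz
    exact isUnit_two_finAdeles.mul_right_eq_zero.1 hz
  refine ⟨integralAdeleMk d hdint, ∑ i, C i ⊗ₜ X i, ∑ i, C' i ⊗ₜ X i, ⟨hiso _ ?_, hiso _ ?_, ?_⟩,
    sum_mem fun i _ => tmul_mem_latticeHat (integralAdeleMk_mem _) (hXL i),
    sum_mem fun i _ => tmul_mem_latticeHat (integralAdeleMk_mem _) (hXL i),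
    fun a ha v => hda v a ha⟩
  · rw [polar_adelicForm_sum]
    refine IsDedekindDomain.FiniteAdeleRing.ext F fun v => ?_
    rw [gramForm_finAdeles_apply]
    exact hcc v
  · rw [polar_adelicForm_sum]
    refine IsDedekindDomain.FiniteAdeleRing.ext F fun v => ?_
    rw [gramForm_finAdeles_apply]
    exact hcc' v
  · rw [polar_adelicForm_sum]
    refine IsDedekindDomain.FiniteAdeleRing.ext F fun v => ?_
    change d v * gramForm Q X (FinAdeles F) C C' v = 1
    rw [gramForm_finAdeles_apply]
    exact hd v

end AdelicLattice

theorem mainTheorem8 {F : Type*} [Field F] [NumberField F] [NumberField.IsTotallyReal F]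
    {V : Type*} [AddCommGroup V] [Module F V] [Module (𝓞 F) V] [IsScalarTower (𝓞 F) F V]
    (Q : QuadraticForm F V) (hQ : (QuadraticMap.polarBilin Q).Nondegenerate)
    (L : Submodule (𝓞 F) V) (hL : L.IsLattice F)
    (heven : IsEvenLattice Q L) (huni : IsZUnimodular Q L)
    (hrank : 5 ≤ Module.finrank (𝓞 F) L) :
    ∃ K : Subgroup (AdelicGSpin Q),
      IsOpen (K : Set (AdelicGSpin Q)) ∧ IsCompact (K : Set (AdelicGSpin Q)) ∧
      (∀ k ∈ K, GeneralSpin.act k '' (latticeHat L : Set (FinAdeles F ⊗[F] V)) =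
        (latticeHat L : Set (FinAdeles F ⊗[F] V))) ∧
      GeneralSpin.spinorNorm '' (K : Set (AdelicGSpin Q)) =
        (fun u : (FinAdeles F)ˣ =>
          algebraMap (FinAdeles F) (CliffordAlgebra (adelicForm Q)) u) ''
          (integralIdeles F : Set (FinAdeles F)ˣ) := by
  obtain ⟨n, X, hX⟩ := Submodule.fg_iff_exists_fin_generating_family.1 hL.fg
  have hfin : Module.Finite F V := by
    refine ⟨?_⟩
    rw [← hL.span_eq_top, ← hX, Submodule.span_span_of_tower]
    exact Submodule.fg_span (Set.finite_range X)
  have hrank' : 3 ≤ Module.finrank F V := by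
    have := Module.Finite.iff_fg.2 hL.fg
    obtain ⟨g, hg⟩ := exists_linearIndependent_of_le_finrank hrank
    have h2 := LinearIndependent.iff_fractionRing (𝓞 F) F |>.1
      (hg.map' L.subtype (Submodule.ker_subtype L))
    have h3 := h2.fintype_card_le_finrank
    rw [Fintype.card_fin] at h3
    omega
  obtain ⟨d, e, f, hef, he, hf, hd⟩ :=
    exists_isHyperbolicPair_adelicForm hL heven huni hrank' hX
  -- Two bases play different roles: `b` lies in `L̂` and gives openness, while `b'` is orthogonal
  -- with unit values of the form and gives scalarity of the spinor norm.
  obtain ⟨b, hb⟩ := exists_basis_mem_latticeHat hL.span_eq_top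
  obtain ⟨b', hu, hoff⟩ := exists_basis_adelicForm_orthogonal Q hQ
  let : Invertible (2 : FinAdeles F) := isUnit_two_finAdeles.invertible
  have : T2Space (FinAdeles F) := t2Space_finAdeles
  have : IsModuleTopology (FinAdeles F) (CliffordAlgebra (adelicForm Q)) := ⟨rfl⟩
  exact GeneralSpin.exists_isOpen_isCompact_subgroup b isOpen_integralAdeles
    isCompact_integralAdeles
    (GeneralSpin.exists_spinorNorm_eq_algebraMap isUnit_two_finAdeles b'.span_eq hu hoff)
    (fg_latticeHat hX) hb hef he hf
    fun x hx y hy => mul_polar_mem_integralAdeles huni hd hx hy
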